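/- Let $k$ be an algebraically closed field, let $N$ be a lattice of finite rank with dual lattice $M=\operatorname{Hom}(N,\mathbb Z)$, and let $\Sigma$ be a smooth complete fan in $N_{\mathbb R}$ with toric variety $X_\Sigma$ over $k$. Let $R(\Sigma)$ be the set of smooth fans subdividing $\Sigma$. A toric $b$-divisor on $X_\Sigma$ is a family $\boldsymbol D=(D_{\Sigma'})_{\Sigma'\in R(\Sigma)}$ of toric $\mathbb Q$-Weil divisors $D_{\Sigma'}=\sum_{\tau\in\Sigma'(1)}a_\tau D_\tau$ on $X_{\Sigma'}$ such that $\pi_*D_{\Sigma''}=D_{\Sigma'}$ whenever $\Sigma''$ is a subdivision of $\Sigma'$ with induced morphism $\pi\colon X_{\Sigma''}\to X_{\Sigma'}$. Its associated function $\tilde\phi$ on the primitive vectors of $N$ is given by $\tilde\phi(v_\tau)=-a_\tau$, where $v_\tau$ is the primitive generator of a ray $\tau$ and $a_\tau$ is the coefficient of $D_\tau$ in $D_{\Sigma'}$ for any $\Sigma'\in R(\Sigma)$ that contains $\tau$. Put $$P_{D_{\Sigma'}}=\{m\in M_{\mathbb R}\mid \langle m,v_\tau\rangle\ge -a_\tau\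 \text{for all }\tau\in\Sigma'(1)\},\qquad \Delta_{\boldsymbol D}=\bigcap_{\Sigma'\in R(\Sigma)}P_{D_{\Sigma'}},$$ and let $$H^0(X_\Sigma,\mathcal O(\boldsymbol D))=\{f\in k(X_\Sigma)^\times\mid \operatorname{div}_{\Sigma'}(f)+\lfloor D_{\Sigma'}\rfloor\ge 0\ \text{on } X_{\Sigma'}\ \text{for all }\Sigma'\in R(\Sigma)\}\cup\{0\}.$$ Then, for every toric $b$-divisor $\boldsymbol D$ on $X_\Sigma$ (not necessarily nef), $$H^0(X_\Sigma,\mathcal O(\boldsymbol D))=\bigoplus_{m\in\Delta_{\boldsymbol D}\cap M}k\cdot\chi^m$$ as subsets of $k(X_\Sigma)$, and $\Delta_{\boldsymbol D}=\{m\in M_{\mathbb R}\mid \langle m,v\rangle\ge\tilde\phi(v)\ \text{for all primitive } v\in N\}$. -/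

import Mathlib

open scoped TensorProduct

namespace ToricB

noncomputable section

/-! ### Lattices and fans -/

/-- The dual lattice `M = Hom(N, ℤ)`. -/
abbrev DualLattice (N : Type*) [AddCommGroup N] : Type _ := Module.Dual ℤ N

/-- `N_ℝ = N ⊗ ℝ`. -/
abbrev NR (N : Type*) [AddCommGroup N] : Type _ := ℝ ⊗[ℤ] N

/-- `M_ℝ = M ⊗ ℝ`. -/
abbrev MR (N : Type*) [AddCommGroup N] : Type _ := ℝ ⊗[ℤ] DualLattice N

/-- The inclusion `N → N_ℝ`. -/
def toNR {N : Type*} [AddCommGroup N] (v : N) : NR N := (1 : ℝ) ⊗ₜ[ℤ] v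

/-- The inclusion `M → M_ℝ`. -/
def toMR {N : Type*} [AddCommGroup N] (m : DualLattice N) : MR N := (1 : ℝ) ⊗ₜ[ℤ] m

/-- The pairing `M_ℝ × N_ℝ → ℝ`, the `ℝ`-bilinear extension of `(m, v) ↦ m v`. -/
def pairing (N : Type*) [AddCommGroup N] : MR N →ₗ[ℝ] NR N →ₗ[ℝ] ℝ :=
  LinearMap.liftBaseChange ℝ (Module.Dual.baseChange ℝ : DualLattice N →ₗ[ℤ] Module.Dual ℝ (NR N))

theorem pairing_toMR_toNR {N : Type*} [AddCommGroup N] (m : DualLattice N) (v : N) :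
    pairing N (toMR m) (toNR v) = (m v : ℝ) := by
  simp [pairing, toMR, toNR]

/-- Primitive lattice vectors (the zero vector is not primitive, take `c = 0`). -/
def IsPrimitive {N : Type*} [AddCommGroup N] (v : N) : Prop :=
  ∀ (c : ℤ) (w : N), v = c • w → IsUnit c

/-- The ray in `N_ℝ` spanned by a lattice vector. -/
def ray {N : Type*} [AddCommGroup N] (v : N) : PointedCone ℝ (NR N) :=
  PointedCone.hull ℝ {toNR v}

/-- A rational polyhedral fan in `N_ℝ`: a finite collection of strongly convex rational polyhedral
cones, closed under passing to faces, any two of which intersect along a common face. -/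
structure Fan (N : Type*) [AddCommGroup N] where
  cones : Set (PointedCone ℝ (NR N))
  finite : cones.Finite
  rational : ∀ σ ∈ cones, ∃ s : Finset N, σ = PointedCone.hull ℝ (toNR '' (s : Set N))
  salient : ∀ σ ∈ cones, (σ : ConvexCone ℝ (NR N)).Salient
  face_mem : ∀ σ ∈ cones, ∀ τ : PointedCone ℝ (NR N), τ.IsFaceOf σ → τ ∈ cones
  inter_isFaceOf : ∀ σ ∈ cones, ∀ τ ∈ cones, (σ ⊓ τ).IsFaceOf σ ∧ (σ ⊓ τ).IsFaceOf τ

namespace Fan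

variable {N : Type*} [AddCommGroup N]

/-- The support `|Σ|`, the union of the cones. -/
def support (S : Fan N) : Set (NR N) := ⋃ σ ∈ S.cones, (σ : Set (NR N))

def IsComplete (S : Fan N) : Prop := S.support = Set.univ

/-- Every cone is generated by part of a `ℤ`-basis of `N`. -/
def IsSmooth (S : Fan N) : Prop :=
  ∀ σ ∈ S.cones, ∃ (b : Module.Basis (Fin (Module.finrank ℤ N)) ℤ N)
    (J : Set (Fin (Module.finrank ℤ N))),
      σ = PointedCone.hull ℝ ((fun i => toNR (b i)) '' J)

/-- `S'.IsSubdivision S`: the fan `S'` is a subdivision of the fan `S`. -/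
def IsSubdivision (S' S : Fan N) : Prop :=
  S'.support = S.support ∧ ∀ σ' ∈ S'.cones, ∃ σ ∈ S.cones, σ' ≤ σ

/-- The set `R(Σ)` of smooth fans subdividing `Σ`. -/
abbrev R (S : Fan N) : Type _ := {S' : Fan N // S'.IsSmooth ∧ S'.IsSubdivision S}

/-- The rays `Σ(1)`; a ray `τ` is recorded by its primitive generator `v_τ`. -/
def rays (S : Fan N) : Set N := {v | IsPrimitive v ∧ ray v ∈ S.cones}

/-- Toric Weil divisors `∑ a_τ D_τ` on `X_Σ`, `τ ∈ Σ(1)`, with coefficients in `A`. -/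
abbrev ToricDiv (S : Fan N) (A : Type*) : Type _ := S.rays → A

open scoped Classical in
/-- Push-forward of toric divisors along the toric morphism `X_{S''} → X_{S'}` given by a
subdivision `S''` of `S'`: the prime divisor `D_τ` goes to `D_τ` if `τ` is a ray of `S'`, and to `0`
(it is contracted) otherwise. -/
def pushforward {A : Type*} [Zero A] (S'' S' : Fan N) (D : S''.ToricDiv A) : S'.ToricDiv A :=
  fun v => if h : (v : N) ∈ S''.rays then D ⟨v, h⟩ else 0

/-- The polyhedron `P_D = {m ∈ M_ℝ | ⟨m, v_τ⟩ ≥ -a_τ for all τ ∈ Σ(1)}` of `D = ∑ a_τ D_τ`. -/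
def polyhedron (S : Fan N) (D : S.ToricDiv ℚ) : Set (MR N) :=
  {m | ∀ v : S.rays, -(D v : ℝ) ≤ pairing N m (toNR (v : N))}

end Fan

/-! ### Toric varieties -/

instance (N : Type*) [AddCommGroup N] : UniqueSums (DualLattice N) :=
  UniqueSums.of_injective_addHom
    ({ toFun := fun m v => m v, map_add' := fun _ _ => rfl } : DualLattice N →ₙ+ (N → ℤ))
    (fun _ _ h => LinearMap.ext fun v => congrFun h v) inferInstance

/-- The function field of every toric variety with torus `Spec k[M]`: the fraction field of the
group algebra `k[M]`. -/
abbrev FunctionField (k : Type*) [Field k] (N : Type*) [AddCommGroup N] : Type _ :=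
  FractionRing (AddMonoidAlgebra k (DualLattice N))

/-- The character `χ^m`. -/
def chi (k : Type*) [Field k] {N : Type*} [AddCommGroup N] (m : DualLattice N) :
    FunctionField k N :=
  algebraMap (AddMonoidAlgebra k (DualLattice N)) (FunctionField k N) (AddMonoidAlgebra.single m 1)

/-- The lattice points `σ^∨ ∩ M` of the dual cone. -/
def dualPoints {N : Type*} [AddCommGroup N] (σ : PointedCone ℝ (NR N)) : Set (DualLattice N) :=
  {m | ∀ x ∈ σ, 0 ≤ pairing N (toMR m) x}

/-- The lattice points `σ^⊥ ∩ M`. -/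
def perpPoints {N : Type*} [AddCommGroup N] (σ : PointedCone ℝ (NR N)) : Set (DualLattice N) :=
  {m | ∀ x ∈ σ, pairing N (toMR m) x = 0}

/-- The coordinate ring `k[σ^∨ ∩ M]` of the affine chart `U_σ`, inside the function field. -/
def chartRing (k : Type*) [Field k] {N : Type*} [AddCommGroup N] (σ : PointedCone ℝ (NR N)) :
    Subring (FunctionField k N) :=
  (Algebra.adjoin k (chi k '' dualPoints σ)).toSubring

/-- The ideal of the closed torus orbit `O(σ)` in the affine chart `U_σ`, generated by the
characters `χ^m` with `m ∈ σ^∨ ∩ M` and `m ∉ σ^⊥`. -/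
def orbitIdeal (k : Type*) [Field k] {N : Type*} [AddCommGroup N] (σ : PointedCone ℝ (NR N)) :
    Ideal (chartRing k σ) :=
  Ideal.span {x | ∃ m ∈ dualPoints σ, m ∉ perpPoints σ ∧ (x : FunctionField k N) = chi k m}

/-- The toric variety `X_Σ`, obtained by gluing the affine charts `U_σ = Spec k[σ^∨ ∩ M]`, `σ ∈ Σ`.
It is an integral separated scheme, so each of its points is determined by its local ring as a
subring of the function field, and `X_Σ` is represented as the collection of these local rings: the
localizations of the chart rings at their prime ideals. -/
def toricVariety (k : Type*) [Field k] {N : Type*} [AddCommGroup N] (S : Fan N) :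
    Set (LocalSubring (FunctionField k N)) :=
  {O | ∃ σ ∈ S.cones, ∃ (P : Ideal (chartRing k σ)) (_ : P.IsPrime),
    O = LocalSubring.ofPrime (chartRing k σ) P}

/-- The prime divisors on `X_Σ`, toric or not, given by their generic points: the points of
codimension one, i.e. those whose local ring has Krull dimension one. -/
abbrev PrimeDivisor (k : Type*) [Field k] {N : Type*} [AddCommGroup N] (S : Fan N) : Type _ :=
  {O : LocalSubring (FunctionField k N) // O ∈ toricVariety k S ∧ ringKrullDim O.toSubring = 1}

/-- `O` is the local ring at the generic point of the toric prime divisor `D_τ`, where `τ` is the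
ray spanned by `v`; `D_τ` is the closure of the orbit `O(τ)`. -/
def IsLocalRingOfToricPrime {k : Type*} [Field k] {N : Type*} [AddCommGroup N] (v : N)
    (O : LocalSubring (FunctionField k N)) : Prop :=
  ∃ _ : (orbitIdeal k (ray v)).IsPrime,
    O = LocalSubring.ofPrime (chartRing k (ray v)) (orbitIdeal k (ray v))

open scoped Classical in
/-- The order of a rational function `f` along a prime divisor with local ring `O`: write `f = a / b`
with `a, b ∈ O`, `b ≠ 0`; then `ord f = length (O / a) - length (O / b)`, independently of the
choice of `a` and `b` if `f ≠ 0`. -/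
def ordAlong {K : Type*} [Field K] (O : Subring K) (f : K) : ℤ :=
  if h : ∃ p : O × O, p.2 ≠ 0 ∧ f = (p.1 : K) / (p.2 : K) then
    ((Ring.ord O h.choose.1).toNat : ℤ) - ((Ring.ord O h.choose.2).toNat : ℤ)
  else 0

/-- Integral Weil divisors on `X_Σ`, as families of coefficients. -/
abbrev WeilDiv (k : Type*) [Field k] {N : Type*} [AddCommGroup N] (S : Fan N) : Type _ :=
  PrimeDivisor k S → ℤ

/-- The principal divisor `div_Σ(f)`. -/
def divisorOf {k : Type*} [Field k] {N : Type*} [AddCommGroup N] (S : Fan N)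
    (f : FunctionField k N) : WeilDiv k S :=
  fun E => ordAlong E.1.toSubring f

open scoped Classical in
/-- The Weil divisor `∑ a_τ D_τ` on `X_Σ`. -/
def toWeilDiv (k : Type*) [Field k] {N : Type*} [AddCommGroup N] {S : Fan N}
    (D : S.ToricDiv ℤ) : WeilDiv k S :=
  fun E => ∑ᶠ v : S.rays, if IsLocalRingOfToricPrime (v : N) E.1 then D v else 0

/-! ### Toric b-divisors -/

/-- A toric (Weil) `b`-divisor on `X_Σ`, an element of the inverse limit over `R(Σ)` of the groups of
toric `ℚ`-Weil divisors under push-forward. -/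
structure ToricBDivisor {N : Type*} [AddCommGroup N] (S : Fan N) where
  /-- The incarnation `D_{Σ'}` on the model `X_{Σ'}`. -/
  inc : ∀ S' : S.R, S'.1.ToricDiv ℚ
  compat : ∀ S'' S' : S.R, S''.1.IsSubdivision S'.1 →
    Fan.pushforward S''.1 S'.1 (inc S'') = inc S'

/-- Families of integral Weil divisors on the models `X_{Σ'}`, `Σ' ∈ R(Σ)`, ordered
coefficientwise. -/
abbrev WeilFamily (k : Type*) [Field k] {N : Type*} [AddCommGroup N] (S : Fan N) : Type _ :=
  ∀ S' : S.R, WeilDiv k S'.1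

/-- The `b`-divisor `b-div(f)` of a rational function. -/
def bdiv {k : Type*} [Field k] {N : Type*} [AddCommGroup N] (S : Fan N)
    (f : FunctionField k N) : WeilFamily k S :=
  fun S' => divisorOf S'.1 f

namespace ToricBDivisor

variable {N : Type*} [AddCommGroup N] {S : Fan N}

/-- `⌊D⌋ = (⌊D_{Σ'}⌋)_{Σ'}`. -/
def floor (k : Type*) [Field k] (D : ToricBDivisor S) : WeilFamily k S :=
  fun S' => toWeilDiv k (fun v => ⌊D.inc S' v⌋)

/-- The space of global sections
`H⁰(X_Σ, O(D)) = {f ∈ k(X_Σ)ˣ | b-div(f) + ⌊D⌋ ≥ 0} ∪ {0}`. -/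
def globalSections (k : Type*) [Field k] (D : ToricBDivisor S) : Set (FunctionField k N) :=
  {f | f ≠ 0 ∧ 0 ≤ bdiv S f + D.floor k} ∪ {0}

/-- The convex set `Δ_D`, the intersection of the polyhedra `P_{D_{Σ'}}`, `Σ' ∈ R(Σ)`. -/
def Delta (D : ToricBDivisor S) : Set (MR N) :=
  ⋂ S' : S.R, S'.1.polyhedron (D.inc S')

open scoped Classical in
/-- The values on primitive vectors of the conical function `φ̃` associated with `D`: take any
`Σ' ∈ R(Σ)` that has the ray `τ` spanned by `v`; then `φ̃(v) = -a_τ`, where `a_τ` is the coefficient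
of `D_τ` in `D_{Σ'}`. -/
def phi (D : ToricBDivisor S) (v : N) : ℚ :=
  if h : ∃ S' : S.R, v ∈ S'.1.rays then -(D.inc h.choose ⟨v, h.choose_spec⟩) else 0

end ToricBDivisor

end

end ToricB

/-!
A rational function `f` on the torus whose order along every non-toric prime divisor is nonnegative
is a Laurent polynomial: `k[M]` is factorial, and a prime factor of the denominator of `f` cuts out
such a divisor. Along the toric divisor of a primitive vector `v`, the order of a Laurent polynomial
`∑ c_m χ^m` is the minimum of `⟨m, v⟩` over its support, because the lowest part of a product is the
product of the lowest parts. Hence the conditions on `f` decouple into the conditions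
`⟨m, v⟩ + ⌊a_v⌋ ≥ 0` on the characters occurring in it, and as `⟨m, v⟩` is an integer these say that
`m ∈ Δ_D`.

For the description of `Δ_D` by `φ̃`, the coefficient `a_v` must not depend on the model, and every
primitive `v` in the support must be a ray of some model. Both follow from star subdivisions at
two-dimensional cones, which keep a fan smooth. Writing `v` as a nonnegative integral combination of
the generators of a cone, replacing `u` and `w` by `u + w` lowers the sum of the coefficients until
only `v` is left. Starring the two-dimensional cones on which an integral linear form changes sign
refines a fan along the hyperplane of that form, and refining along the facet hyperplanes of a
second smooth fan with the same support produces a common smooth subdivision.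
-/

namespace ToricB

noncomputable section

/-! ### Unimodular cones -/

section Cones

variable {N : Type*} [AddCommGroup N]

/-- The linear combination `∑ c_v v ∈ N_ℝ` of lattice vectors. -/
def comb (N : Type*) [AddCommGroup N] : (N →₀ ℝ) →ₗ[ℝ] NR N := Finsupp.linearCombination ℝ toNR

/-- The rational polyhedral cone spanned by a finite set of lattice vectors. -/
def coneOf (A : Finset N) : PointedCone ℝ (NR N) := PointedCone.hull ℝ (toNR '' (A : Set N))

/-- A finite set of lattice vectors is unimodular if it is part of a `ℤ`-basis of `N`; these are the
sets of generators of the smooth cones. -/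
def IsUnimodular (A : Finset N) : Prop :=
  ∃ b : Module.Basis (Fin (Module.finrank ℤ N)) ℤ N, (A : Set N) ⊆ Set.range b

theorem toNR_add (v w : N) : toNR (v + w) = toNR v + toNR w := TensorProduct.tmul_add _ _ _

theorem toNR_sum {ι : Type*} (s : Finset ι) (f : ι → N) :
    toNR (∑ i ∈ s, f i) = ∑ i ∈ s, toNR (f i) :=
  map_sum (AddMonoidHom.mk' toNR toNR_add) f s

theorem toNR_zsmul (n : ℤ) (v : N) : toNR (n • v) = (n : ℝ) • toNR v := by
  rw [Int.cast_smul_eq_zsmul]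
  exact map_zsmul (AddMonoidHom.mk' toNR toNR_add) n v

theorem toNR_injective [Module.Free ℤ N] : Function.Injective (toNR : N → NR N) := by
  intro v w h
  refine (Module.Free.chooseBasis ℤ N).ext_elem fun i => ?_
  have := congrArg (pairing N (toMR ((Module.Free.chooseBasis ℤ N).coord i))) h
  simpa [pairing_toMR_toNR] using this

@[simp] theorem comb_single (v : N) (r : ℝ) : comb N (Finsupp.single v r) = r • toNR v := by
  simp [comb]

theorem pairing_comb (m : DualLattice N) (c : N →₀ ℝ) :
    pairing N (toMR m) (comb N c) = c.sum fun v r => r * (m v : ℝ) := by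
  rw [comb, Finsupp.linearCombination_apply, map_finsuppSum]
  simp [pairing_toMR_toNR]

theorem ray_eq_coneOf (v : N) : ray v = coneOf {v} := by simp [ray, coneOf]

theorem coneOf_empty : coneOf (∅ : Finset N) = ⊥ := by simp [coneOf, PointedCone.hull]

theorem toNR_mem_coneOf {A : Finset N} {v : N} (h : v ∈ A) : toNR v ∈ coneOf A :=
  PointedCone.subset_hull ⟨v, h, rfl⟩

theorem coneOf_le {A : Finset N} {C : PointedCone ℝ (NR N)} :
    coneOf A ≤ C ↔ ∀ v ∈ A, toNR v ∈ C := by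
  rw [coneOf, Submodule.span_le, Set.image_subset_iff]
  rfl

theorem coneOf_mono {A B : Finset N} (h : A ⊆ B) : coneOf A ≤ coneOf B :=
  coneOf_le.2 fun _ hv => toNR_mem_coneOf (h hv)

theorem comb_mem {C : PointedCone ℝ (NR N)} {c : N →₀ ℝ} (hc : 0 ≤ c)
    (h : ∀ v ∈ c.support, toNR v ∈ C) : comb N c ∈ C := by
  rw [comb, Finsupp.linearCombination_apply]
  exact C.sum_mem fun v hv => C.smul_mem (hc v) (h v hv)

theorem mem_coneOf {A : Finset N} {x : NR N} :
    x ∈ coneOf A ↔ ∃ c : N →₀ ℝ, 0 ≤ c ∧ c.support ⊆ A ∧ comb N c = x := by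
  classical
  refine ⟨fun h => ?_, ?_⟩
  · induction h using Submodule.span_induction with
    | mem _ hx =>
      obtain ⟨v, hv, rfl⟩ := hx
      exact ⟨Finsupp.single v 1, by simp,
        Finsupp.support_single_subset.trans (by simpa using hv), by simp⟩
    | zero => exact ⟨0, le_rfl, by simp, by simp⟩
    | add _ _ _ _ hx hy =>
      obtain ⟨c, hc, hA, rfl⟩ := hx
      obtain ⟨d, hd, hB, rfl⟩ := hy
      exact ⟨c + d, add_nonneg hc hd, Finsupp.support_add.trans (Finset.union_subset hA hB),
        map_add _ _ _⟩
    | smul r _ _ hx =>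
      obtain ⟨c, hc, hA, rfl⟩ := hx
      exact ⟨(r : ℝ) • c, smul_nonneg r.2 hc, Finsupp.support_smul.trans hA, map_smul _ _ _⟩
  · rintro ⟨c, hc, hA, rfl⟩
    exact comb_mem hc fun v hv => toNR_mem_coneOf (hA hv)

theorem mem_ray {v : N} {x : NR N} : x ∈ ray v ↔ ∃ r : ℝ, 0 ≤ r ∧ x = r • toNR v := by
  refine ⟨fun h => ?_, ?_⟩
  · obtain ⟨r, rfl⟩ := Submodule.mem_span_singleton.1 h
    exact ⟨r, r.2, rfl⟩
  · rintro ⟨r, hr, rfl⟩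
    exact (ray v).smul_mem hr (PointedCone.subset_hull rfl)

theorem mem_dualPoints_coneOf {A : Finset N} {m : DualLattice N} :
    m ∈ dualPoints (coneOf A) ↔ ∀ v ∈ A, 0 ≤ m v := by
  refine ⟨fun h v hv => ?_, fun h x hx => ?_⟩
  · have := h _ (toNR_mem_coneOf hv)
    rw [pairing_toMR_toNR] at this
    exact_mod_cast this
  · obtain ⟨c, hc, hA, rfl⟩ := mem_coneOf.1 hx
    rw [pairing_comb]
    exact Finset.sum_nonneg fun v hv => mul_nonneg (hc v) (by exact_mod_cast h v (hA hv))

theorem pairing_eq_zero_of_mem_coneOf {A : Finset N} {m : DualLattice N} (h : ∀ v ∈ A, m v = 0)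
    {x : NR N} (hx : x ∈ coneOf A) : pairing N (toMR m) x = 0 := by
  obtain ⟨c, -, hA, rfl⟩ := mem_coneOf.1 hx
  rw [pairing_comb]
  exact Finset.sum_eq_zero fun v hv => by simp [h v (hA hv)]

theorem toNR_mem_coneOf_iff {ι : Type*} [Finite ι] (b : Module.Basis ι ℤ N) {A : Finset N}
    (hA : (A : Set N) ⊆ Set.range b) {v : N} :
    toNR v ∈ coneOf A ↔ ∀ i, 0 ≤ b.coord i v ∧ (b i ∉ A → b.coord i v = 0) := by
  classical
  have := Fintype.ofFinite ι
  refine ⟨fun hv i => ⟨?_, fun hi => ?_⟩, fun h => ?_⟩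
  · have hcoord : b.coord i ∈ dualPoints (coneOf A) := mem_dualPoints_coneOf.2 fun w hw => by
      obtain ⟨j, rfl⟩ := hA hw
      simp only [Module.Basis.coord_apply, Module.Basis.repr_self]
      exact (Finsupp.single_nonneg.2 zero_le_one) i
    have := hcoord _ hv
    rw [pairing_toMR_toNR] at this
    exact_mod_cast this
  · have hcoord : ∀ w ∈ A, b.coord i w = 0 := fun w hw => by
      obtain ⟨j, rfl⟩ := hA hw
      have hij : i ≠ j := by rintro rfl; exact hi hw
      simp [hij.symm]
    have := pairing_eq_zero_of_mem_coneOf hcoord hv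
    rw [pairing_toMR_toNR] at this
    exact_mod_cast this
  · rw [← b.sum_repr v, toNR_sum]
    refine (coneOf A).sum_mem fun i _ => ?_
    rw [toNR_zsmul]
    by_cases hi : b i ∈ A
    · exact (coneOf A).smul_mem (by exact_mod_cast (h i).1) (toNR_mem_coneOf hi)
    · have := (h i).2 hi
      rw [Module.Basis.coord_apply] at this
      simp [this]

namespace IsUnimodular

theorem mono {A B : Finset N} (h : IsUnimodular A) (hB : B ⊆ A) : IsUnimodular B :=
  let ⟨b, hb⟩ := h
  ⟨b, fun _ hx => hb (hB hx)⟩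

theorem exists_dual {A : Finset N} (h : IsUnimodular A) {v : N} (hv : v ∈ A) :
    ∃ m : DualLattice N, m v = 1 ∧ ∀ w ∈ A, w ≠ v → m w = 0 := by
  obtain ⟨b, hb⟩ := h
  obtain ⟨i, rfl⟩ := hb hv
  refine ⟨b.coord i, by simp, fun w hw hne => ?_⟩
  obtain ⟨j, rfl⟩ := hb hw
  have : j ≠ i := fun h => hne (by rw [h])
  simp [this]

theorem comb_injOn {A : Finset N} (h : IsUnimodular A) :
    Set.InjOn (comb N) {c | c.support ⊆ A} := by
  intro c hc d hd hcd
  by_contra hne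
  obtain ⟨v, hv⟩ := Finsupp.support_nonempty_iff.2 (sub_ne_zero.2 hne)
  classical
  have hA : (c - d).support ⊆ A := Finsupp.support_sub.trans (Finset.union_subset hc hd)
  obtain ⟨m, hmv, hm⟩ := h.exists_dual (hA hv)
  have hsum : ((c - d).sum fun w r => r * (m w : ℝ)) = (c - d) v := by
    rw [Finsupp.sum, Finset.sum_eq_single_of_mem v hv
      fun w hw hwv => by simp [hm w (hA hw) hwv], hmv, Int.cast_one, mul_one]
  rw [← pairing_comb, map_sub, hcd, sub_self, map_zero] at hsum
  exact Finsupp.mem_support_iff.1 hv hsum.symm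

theorem isPrimitive {A : Finset N} (h : IsUnimodular A) {v : N} (hv : v ∈ A) :
    IsPrimitive v := by
  intro c w hcw
  obtain ⟨m, hm, -⟩ := h.exists_dual hv
  rw [hcw, map_smul, smul_eq_mul] at hm
  exact IsUnit.of_mul_eq_one _ hm

end IsUnimodular

theorem IsPrimitive.ne_zero {v : N} (h : IsPrimitive v) : v ≠ 0 := by
  rintro rfl
  simpa using h 0 0 (by simp)

theorem IsPrimitive.toNR_ne_zero [Module.Free ℤ N] {v : N} (h : IsPrimitive v) : toNR v ≠ 0 :=
  fun h0 => h.ne_zero (toNR_injective (h0.trans (by simp [toNR])))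

theorem IsPrimitive.eq_of_toNR_mem_ray [Module.Free ℤ N] {v w : N} (hv : IsPrimitive v)
    (hw : IsUnimodular {w}) (h : toNR v ∈ ray w) : v = w := by
  obtain ⟨r, hr, hvw⟩ := mem_ray.1 h
  obtain ⟨m, hm, -⟩ := hw.exists_dual (Finset.mem_singleton_self w)
  have hmv : (m v : ℝ) = r := by
    rw [← pairing_toMR_toNR, hvw, map_smul, pairing_toMR_toNR, hm]
    simp
  have hv_eq : v = m v • w := toNR_injective (by rw [toNR_zsmul, hmv, hvw])
  have hnonneg : 0 ≤ m v := by rw [← hmv] at hr; exact_mod_cast hr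
  have hone : m v = 1 := by
    have := Int.isUnit_iff.1 (hv _ _ hv_eq)
    omega
  rw [hv_eq, hone, one_smul]

theorem toNR_mem_of_comb_mem {F C : PointedCone ℝ (NR N)} (hF : F.IsFaceOf C) {c : N →₀ ℝ}
    (hc : 0 ≤ c) (hC : ∀ v ∈ c.support, toNR v ∈ C) (h : comb N c ∈ F) {v : N}
    (hv : v ∈ c.support) : toNR v ∈ F := by
  classical
  have hpos : 0 < c v := lt_of_le_of_ne (hc v) (Ne.symm (Finsupp.mem_support_iff.1 hv))
  refine hF.mem_of_smul_add_mem (y := comb N (c.erase v)) (hC v hv) ?_ hpos ?_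
  · refine comb_mem (fun w => ?_) fun w hw => ?_
    · by_cases hwv : w = v
      · simp [hwv]
      · simpa [Finsupp.erase_ne hwv] using hc w
    · rw [Finsupp.support_erase] at hw
      exact hC w (Finset.mem_of_mem_erase hw)
  · rwa [← comb_single, ← map_add, Finsupp.single_add_erase]

theorem eq_coneOf_of_isFaceOf {A : Finset N} {τ : PointedCone ℝ (NR N)}
    (h : τ.IsFaceOf (coneOf A)) : ∃ B ⊆ A, τ = coneOf B := by
  classical
  refine ⟨A.filter fun a => toNR a ∈ τ, Finset.filter_subset _ _, le_antisymm (fun x hx => ?_)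
    (coneOf_le.2 fun v hv => (Finset.mem_filter.1 hv).2)⟩
  obtain ⟨c, hc, hcA, rfl⟩ := mem_coneOf.1 (h.le hx)
  exact mem_coneOf.2 ⟨c, hc, fun v hv => Finset.mem_filter.2 ⟨hcA hv, toNR_mem_of_comb_mem h hc
    (fun w hw => toNR_mem_coneOf (hcA hw)) hx hv⟩, rfl⟩

namespace IsUnimodular

theorem isFaceOf_coneOf {A B : Finset N} (hA : IsUnimodular A) (hB : B ⊆ A) :
    (coneOf B).IsFaceOf (coneOf A) := by
  classical
  refine ⟨coneOf_mono hB, fun {x y t} hx hy ht hxy => ?_⟩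
  obtain ⟨c, hc, hcA, rfl⟩ := mem_coneOf.1 hx
  obtain ⟨d, hd, hdA, rfl⟩ := mem_coneOf.1 hy
  obtain ⟨e, -, heB, hexy⟩ := mem_coneOf.1 hxy
  have he : t • c + d = e := by
    refine hA.comb_injOn ?_ (heB.trans hB) (by rw [hexy, map_add, map_smul])
    exact Finsupp.support_add.trans (Finset.union_subset (Finsupp.support_smul.trans hcA) hdA)
  refine mem_coneOf.2 ⟨c, hc, fun v hv => heB ?_, rfl⟩
  have hcv : 0 < c v := lt_of_le_of_ne (hc v) (Ne.symm (Finsupp.mem_support_iff.1 hv))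
  rw [Finsupp.mem_support_iff, ← he]
  exact (add_pos_of_pos_of_nonneg (mul_pos ht hcv) (hd v)).ne'

theorem subset_of_coneOf_eq [Module.Free ℤ N] {A B : Finset N} (hA : IsUnimodular A)
    (hB : IsUnimodular B) (h : coneOf A = coneOf B) : A ⊆ B := by
  intro a ha
  have hface : (ray a).IsFaceOf (coneOf B) := by
    rw [← h, ray_eq_coneOf]
    exact hA.isFaceOf_coneOf (Finset.singleton_subset_iff.2 ha)
  obtain ⟨C, hCB, hC⟩ := eq_coneOf_of_isFaceOf hface
  obtain rfl | ⟨b, hb⟩ := C.eq_empty_or_nonempty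
  · have : toNR a ∈ ray a := PointedCone.subset_hull rfl
    rw [hC, coneOf_empty] at this
    exact absurd (by simpa using this) (hA.isPrimitive ha).toNR_ne_zero
  · have hba : b = a := (hB.isPrimitive (hCB hb)).eq_of_toNR_mem_ray
      (hA.mono (Finset.singleton_subset_iff.2 ha)) (hC ▸ toNR_mem_coneOf hb)
    exact hba ▸ hCB hb

theorem coneOf_injective [Module.Free ℤ N] {A B : Finset N} (hA : IsUnimodular A)
    (hB : IsUnimodular B) (h : coneOf A = coneOf B) : A = B :=
  (hA.subset_of_coneOf_eq hB h).antisymm (hB.subset_of_coneOf_eq hA h.symm)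

end IsUnimodular

end Cones

/-! ### Smooth fans as simplicial complexes -/

/-- The combinatorial data of a smooth fan: a finite simplicial complex of unimodular sets of
lattice vectors such that a point of `N_ℝ` has at most one expression as a nonnegative combination
supported on a face. -/
structure SmoothComplex (N : Type*) [AddCommGroup N] where
  faces : Set (Finset N)
  finite : faces.Finite
  empty_mem : ∅ ∈ faces
  down_closed : ∀ A ∈ faces, ∀ B ⊆ A, B ∈ faces
  unimodular : ∀ A ∈ faces, IsUnimodular A
  comb_injOn : Set.InjOn (comb N) {c | 0 ≤ c ∧ c.support ∈ faces}

theorem Fan.eq_of_cones_eq {N : Type*} [AddCommGroup N] {S T : Fan N} (h : S.cones = T.cones) :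
    S = T := by
  cases S; cases T; cases h; rfl

theorem Fan.mem_support {N : Type*} [AddCommGroup N] {S : Fan N} {x : NR N} :
    x ∈ S.support ↔ ∃ σ ∈ S.cones, x ∈ σ := by
  simp only [support, Set.mem_iUnion, exists_prop, SetLike.mem_coe]

theorem Fan.IsSubdivision.refl {N : Type*} [AddCommGroup N] (S : Fan N) : S.IsSubdivision S :=
  ⟨rfl, fun σ h => ⟨σ, h, le_rfl⟩⟩

theorem Fan.IsSubdivision.trans {N : Type*} [AddCommGroup N] {S T U : Fan N}
    (h : S.IsSubdivision T) (h' : T.IsSubdivision U) : S.IsSubdivision U := by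
  refine ⟨h.1.trans h'.1, fun σ hσ => ?_⟩
  obtain ⟨τ, hτ, hle⟩ := h.2 σ hσ
  obtain ⟨ρ, hρ, hle'⟩ := h'.2 τ hτ
  exact ⟨ρ, hρ, hle.trans hle'⟩

theorem Fan.IsSmooth.exists_eq_coneOf {N : Type*} [AddCommGroup N] {S : Fan N} (hS : S.IsSmooth)
    {σ : PointedCone ℝ (NR N)} (hσ : σ ∈ S.cones) :
    ∃ A : Finset N, IsUnimodular A ∧ σ = coneOf A := by
  classical
  obtain ⟨b, J, rfl⟩ := hS σ hσ
  refine ⟨J.toFinset.image b, ⟨b, by simp⟩, ?_⟩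
  rw [coneOf]
  congr 1
  simp [Set.image_image]

theorem Fan.comb_injOn {N : Type*} [AddCommGroup N] [Module.Free ℤ N] (S : Fan N) :
    Set.InjOn (comb N) {c | 0 ≤ c ∧ IsUnimodular c.support ∧ coneOf c.support ∈ S.cones} := by
  rintro c ⟨hc, huc, hcS⟩ d ⟨hd, hud, hdS⟩ hcd
  have hmem : ∀ {c : N →₀ ℝ}, 0 ≤ c → comb N c ∈ coneOf c.support := fun {c} hc =>
    mem_coneOf.2 ⟨c, hc, subset_rfl, rfl⟩
  obtain ⟨hfc, hfd⟩ := S.inter_isFaceOf _ hcS _ hdS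
  have hle : coneOf c.support ≤ coneOf d.support := coneOf_le.2 fun v hv =>
    (toNR_mem_of_comb_mem hfc hc (fun w hw => toNR_mem_coneOf hw)
      ⟨hmem hc, hcd ▸ hmem hd⟩ hv).2
  have hge : coneOf d.support ≤ coneOf c.support := coneOf_le.2 fun v hv =>
    (toNR_mem_of_comb_mem hfd hd (fun w hw => toNR_mem_coneOf hw)
      ⟨hcd ▸ hmem hc, hmem hd⟩ hv).1
  have hsupp := huc.coneOf_injective hud (le_antisymm hle hge)
  exact huc.comb_injOn (Finset.Subset.refl _) hsupp.ge hcd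

namespace SmoothComplex

section ToFan

variable {N : Type*} [AddCommGroup N] (K : SmoothComplex N)

theorem pair_mem [DecidableEq N] {A : Finset N} (hA : A ∈ K.faces) {u w : N} (hu : u ∈ A)
    (hw : w ∈ A) : {u, w} ∈ K.faces :=
  K.down_closed A hA _ (Finset.insert_subset hu (Finset.singleton_subset_iff.2 hw))

theorem coneOf_inf [DecidableEq N] {A B : Finset N} (hA : A ∈ K.faces) (hB : B ∈ K.faces) :
    coneOf A ⊓ coneOf B = coneOf (A ∩ B) := by
  refine le_antisymm ?_ (le_inf (coneOf_mono Finset.inter_subset_left)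
    (coneOf_mono Finset.inter_subset_right))
  rintro x ⟨hxA, hxB⟩
  obtain ⟨c, hc, hcA, rfl⟩ := mem_coneOf.1 hxA
  obtain ⟨d, hd, hdB, hcd⟩ := mem_coneOf.1 hxB
  obtain rfl : d = c := K.comb_injOn ⟨hd, K.down_closed _ hB _ hdB⟩
    ⟨hc, K.down_closed _ hA _ hcA⟩ hcd
  exact mem_coneOf.2 ⟨d, hd, Finset.subset_inter hcA hdB, rfl⟩

theorem salient_coneOf {A : Finset N} (hA : A ∈ K.faces) :
    (coneOf A : ConvexCone ℝ (NR N)).Salient := by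
  classical
  intro x hx hx0 hnx
  obtain ⟨c, hc, hcA, rfl⟩ := mem_coneOf.1 hx
  obtain ⟨d, hd, hdA, hcd⟩ := mem_coneOf.1 hnx
  have hsum : c + d = 0 := (K.unimodular A hA).comb_injOn
    (Finsupp.support_add.trans (Finset.union_subset hcA hdA)) (by simp) (by simp [hcd])
  have hc0 : c = 0 := le_antisymm (by rw [← hsum]; exact le_add_of_nonneg_right hd) hc
  exact hx0 (by rw [hc0, map_zero])

/-- The fan whose cones are spanned by the faces. -/
def toFan : Fan N where
  cones := coneOf '' K.faces
  finite := K.finite.image _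
  rational := by
    rintro _ ⟨A, -, rfl⟩
    exact ⟨A, rfl⟩
  salient := by
    rintro _ ⟨A, hA, rfl⟩
    exact K.salient_coneOf hA
  face_mem := by
    rintro _ ⟨A, hA, rfl⟩ τ hτ
    obtain ⟨B, hB, rfl⟩ := eq_coneOf_of_isFaceOf hτ
    exact ⟨B, K.down_closed A hA B hB, rfl⟩
  inter_isFaceOf := by
    rintro _ ⟨A, hA, rfl⟩ _ ⟨B, hB, rfl⟩
    classical
    rw [K.coneOf_inf hA hB]
    exact ⟨(K.unimodular A hA).isFaceOf_coneOf Finset.inter_subset_left,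
      (K.unimodular B hB).isFaceOf_coneOf Finset.inter_subset_right⟩

variable {K} in
theorem coneOf_mem_toFan {A : Finset N} (hA : A ∈ K.faces) : coneOf A ∈ K.toFan.cones :=
  ⟨A, hA, rfl⟩

theorem isSmooth_toFan : K.toFan.IsSmooth := by
  rintro _ ⟨A, hA, rfl⟩
  obtain ⟨b, hb⟩ := K.unimodular A hA
  refine ⟨b, b ⁻¹' A, ?_⟩
  rw [coneOf, ← Set.image_image toNR b, Set.image_preimage_eq_of_subset hb]

theorem mem_support_toFan {x : NR N} :
    x ∈ K.toFan.support ↔ ∃ c : N →₀ ℝ, 0 ≤ c ∧ c.support ∈ K.faces ∧ comb N c = x := by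
  rw [Fan.mem_support]
  constructor
  · rintro ⟨_, ⟨A, hA, rfl⟩, hx⟩
    obtain ⟨c, hc, hcA, rfl⟩ := mem_coneOf.1 hx
    exact ⟨c, hc, K.down_closed A hA _ hcA, rfl⟩
  · rintro ⟨c, hc, hcA, rfl⟩
    exact ⟨_, coneOf_mem_toFan hcA, mem_coneOf.2 ⟨c, hc, subset_rfl, rfl⟩⟩

theorem mem_rays_toFan [Module.Free ℤ N] {v : N} : v ∈ K.toFan.rays ↔ {v} ∈ K.faces := by
  refine ⟨?_, fun h => ⟨(K.unimodular _ h).isPrimitive (Finset.mem_singleton_self v),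
    ray_eq_coneOf v ▸ coneOf_mem_toFan h⟩⟩
  rintro ⟨hv, A, hA, hAv⟩
  have hne : A.Nonempty := by
    rw [Finset.nonempty_iff_ne_empty]
    rintro rfl
    have : toNR v ∈ ray v := PointedCone.subset_hull rfl
    rw [← hAv, coneOf_empty] at this
    exact hv.toNR_ne_zero (by simpa using this)
  have heq : ∀ a ∈ A, a = v := by
    intro a ha
    have hsub := (K.unimodular A hA).mono (Finset.singleton_subset_iff.2 ha)
    obtain ⟨r, hr, har⟩ := mem_ray.1 (hAv ▸ toNR_mem_coneOf ha)
    have hr0 : r ≠ 0 := by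
      rintro rfl
      exact (hsub.isPrimitive (Finset.mem_singleton_self a)).toNR_ne_zero (by simpa using har)
    refine (hv.eq_of_toNR_mem_ray hsub (mem_ray.2 ⟨r⁻¹, inv_nonneg.2 hr, ?_⟩)).symm
    rw [har, inv_smul_smul₀ hr0]
  rwa [← Finset.eq_singleton_iff_nonempty_unique_mem.2 ⟨hne, heq⟩]

theorem exists_toFan_eq [Module.Free ℤ N] {S : Fan N} (hS : S.IsSmooth) (hne : S.cones.Nonempty) :
    ∃ K : SmoothComplex N, K.toFan = S := by
  let K : SmoothComplex N :=
    { faces := {A | IsUnimodular A ∧ coneOf A ∈ S.cones}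
      finite := Set.Finite.of_finite_image (f := coneOf)
        (S.finite.subset (by rintro _ ⟨A, hA, rfl⟩; exact hA.2))
        (fun A hA B hB h => hA.1.coneOf_injective hB.1 h)
      empty_mem := by
        obtain ⟨σ, hσ⟩ := hne
        obtain ⟨A, hA, rfl⟩ := hS.exists_eq_coneOf hσ
        exact ⟨hA.mono (Finset.empty_subset A),
          S.face_mem _ hσ _ (hA.isFaceOf_coneOf (Finset.empty_subset A))⟩
      down_closed := fun A hA B hB => ⟨hA.1.mono hB, S.face_mem _ hA.2 _ (hA.1.isFaceOf_coneOf hB)⟩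
      unimodular := fun A hA => hA.1
      comb_injOn := S.comb_injOn }
  refine ⟨K, Fan.eq_of_cones_eq (Set.Subset.antisymm ?_ fun σ hσ => ?_)⟩
  · rintro _ ⟨A, hA, rfl⟩
    exact hA.2
  · obtain ⟨A, hA, rfl⟩ := hS.exists_eq_coneOf hσ
    exact ⟨A, ⟨hA, hσ⟩, rfl⟩

end ToFan

end SmoothComplex

/-! ### Star subdivisions -/

section Exchange

variable {N R : Type*} [AddCommGroup N]

/-- Replace the vector `u + w` by `u` and `w` in a formal linear combination. -/
def collapse [AddCommGroup R] (u w : N) (c : N →₀ R) : N →₀ R :=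
  c - Finsupp.single (u + w) (c (u + w)) + Finsupp.single w (c (u + w)) +
    Finsupp.single u (c (u + w))

/-- Replace as many copies of `u` and `w` as possible by copies of `u + w` in a formal linear
combination with nonnegative coefficients. -/
def expand [AddCommGroup R] [LinearOrder R] (u w : N) (c : N →₀ R) : N →₀ R :=
  c - Finsupp.single u (min (c u) (c w)) - Finsupp.single w (min (c u) (c w)) +
    Finsupp.single (u + w) (min (c u) (c w))

variable {u w : N}

section Collapse

variable [AddCommGroup R]

theorem collapse_apply_left (hne : u ≠ w) (hu : u + w ≠ u) (c : N →₀ R) :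
    collapse u w c u = c u + c (u + w) := by
  simp [collapse, hne, hu.symm]

theorem collapse_apply_right (hne : u ≠ w) (hw : u + w ≠ w) (c : N →₀ R) :
    collapse u w c w = c w + c (u + w) := by
  simp [collapse, hne.symm, hw.symm]

theorem collapse_eq_self {c : N →₀ R} (h : c (u + w) = 0) : collapse u w c = c := by
  simp [collapse, h]

theorem support_collapse_subset [DecidableEq N] (c : N →₀ R) :
    (collapse u w c).support ⊆ c.support.erase (u + w) ∪ {u, w} := by
  intro x hx
  contrapose! hx
  simp only [Finset.mem_union, Finset.mem_erase, Finset.mem_insert, Finset.mem_singleton,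
    Finsupp.mem_support_iff, not_or, not_and, not_not] at hx ⊢
  obtain ⟨hcx, hxu, hxw⟩ := hx
  by_cases hx : x = u + w
  · subst hx
    simp [collapse, hxu, hxw]
  · simp [collapse, hxu, hxw, hx, hcx hx]

theorem collapse_nonneg [PartialOrder R] [IsOrderedAddMonoid R] {c : N →₀ R} (hc : 0 ≤ c) :
    0 ≤ collapse u w c := by
  refine add_nonneg (add_nonneg (sub_nonneg.2 fun x => ?_) ?_) ?_
  · by_cases hx : x = u + w
    · simp [hx]
    · simpa [hx] using hc x
  all_goals exact Finsupp.single_nonneg.2 (hc _)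

end Collapse

theorem comb_collapse (c : N →₀ ℝ) : comb N (collapse u w c) = comb N c := by
  simp only [collapse, map_add, map_sub, comb_single, toNR_add, smul_add]
  abel

section Expand

variable [AddCommGroup R] [LinearOrder R]

theorem linearCombination_expand {S E : Type*} [Ring S] [LinearOrder S] [AddCommGroup E]
    [Module S E] {f : N → E} (hf : f (u + w) = f u + f w) (c : N →₀ S) :
    Finsupp.linearCombination S f (expand u w c) = Finsupp.linearCombination S f c := by
  simp only [expand, map_add, map_sub, Finsupp.linearCombination_single, hf, smul_add]
  abel

theorem degree_expand (c : N →₀ R) :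
    (expand u w c).degree = c.degree - min (c u) (c w) := by
  simp [expand]

theorem expand_apply_left (hne : u ≠ w) (hu : u + w ≠ u) (c : N →₀ R) :
    expand u w c u = c u - min (c u) (c w) := by
  simp [expand, hne, hu.symm]

theorem expand_apply_right (hne : u ≠ w) (hw : u + w ≠ w) (c : N →₀ R) :
    expand u w c w = c w - min (c u) (c w) := by
  simp [expand, hne.symm, hw.symm]

theorem expand_apply_add (hu : u + w ≠ u) (hw : u + w ≠ w) (c : N →₀ R) :
    expand u w c (u + w) = c (u + w) + min (c u) (c w) := by
  simp only [expand, Finsupp.add_apply, Finsupp.sub_apply, Finsupp.single_eq_of_ne hu,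
    Finsupp.single_eq_of_ne hw, Finsupp.single_eq_same, sub_zero]

theorem expand_apply_of_ne {x : N} (hu : x ≠ u) (hw : x ≠ w) (hx : x ≠ u + w) (c : N →₀ R) :
    expand u w c x = c x := by
  simp [expand, hu, hw, hx]

variable [IsOrderedAddMonoid R]

theorem expand_nonneg (hne : u ≠ w) (hu : u + w ≠ u) (hw : u + w ≠ w) {c : N →₀ R} (hc : 0 ≤ c) :
    0 ≤ expand u w c := by
  intro x
  change 0 ≤ expand u w c x
  by_cases hxu : x = u
  · rw [hxu, expand_apply_left hne hu]
    exact sub_nonneg.2 (min_le_left _ _)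
  by_cases hxw : x = w
  · rw [hxw, expand_apply_right hne hw]
    exact sub_nonneg.2 (min_le_right _ _)
  by_cases hxe : x = u + w
  · rw [hxe, expand_apply_add hu hw]
    exact add_nonneg (hc _) (le_min (hc u) (hc w))
  · rw [expand_apply_of_ne hxu hxw hxe]
    exact hc x

theorem expand_collapse (hne : u ≠ w) (hu : u + w ≠ u) (hw : u + w ≠ w) {c : N →₀ R} (hc : 0 ≤ c)
    (h : c u = 0 ∨ c w = 0) : expand u w (collapse u w c) = c := by
  have hmin : min (collapse u w c u) (collapse u w c w) = c (u + w) := by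
    rw [collapse_apply_left hne hu, collapse_apply_right hne hw, min_add_add_right,
      add_eq_right]
    obtain h0 | h0 := h
    · rw [h0]
      exact min_eq_left (hc w)
    · rw [h0]
      exact min_eq_right (hc u)
  rw [expand, hmin, collapse]
  abel

end Expand

end Exchange

theorem IsUnimodular.insert_add_erase {N : Type*} [AddCommGroup N] [DecidableEq N] {F : Finset N}
    (hF : IsUnimodular F) {u w : N} (hu : u ∈ F) (hw : w ∈ F) (hne : u ≠ w) :
    IsUnimodular (insert (u + w) (F.erase u)) := by
  obtain ⟨b, hb⟩ := hF
  obtain ⟨i, rfl⟩ := hb hu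
  obtain ⟨j, rfl⟩ := hb hw
  have hij : j ≠ i := fun h => hne (by rw [h])
  have hcoord : b.coord i (b j) = 0 := by simp [hij]
  refine ⟨b.map (LinearEquiv.transvection hcoord), fun x hx => ?_⟩
  obtain rfl | hx := Finset.mem_insert.1 (Finset.mem_coe.1 hx)
  · exact ⟨i, by simp [LinearMap.transvection.apply]⟩
  · obtain ⟨hxi, hxF⟩ := Finset.mem_erase.1 hx
    obtain ⟨l, rfl⟩ := hb hxF
    have hl : l ≠ i := fun h => hxi (by rw [h])
    exact ⟨l, by simp [LinearMap.transvection.apply, hl]⟩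

namespace SmoothComplex

section Star

variable {N : Type*} [AddCommGroup N] [DecidableEq N] (K : SmoothComplex N) {u w : N}

/-- The faces of the star subdivision at the face `{u, w}`, with new vertex `u + w`. -/
def starFaces (u w : N) : Set (Finset N) :=
  {A | ¬ {u, w} ⊆ A ∧ (A ∈ K.faces ∨ (u + w ∈ A ∧ A.erase (u + w) ∪ {u, w} ∈ K.faces))}

theorem add_ne_left (h : {u, w} ∈ K.faces) : u + w ≠ u := by
  simpa using ((K.unimodular _ h).isPrimitive (v := w) (by simp)).ne_zero

theorem add_ne_right (h : {u, w} ∈ K.faces) : u + w ≠ w := by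
  simpa using ((K.unimodular _ h).isPrimitive (v := u) (by simp)).ne_zero

theorem add_notMem_of_mem_faces (h : {u, w} ∈ K.faces) {A : Finset N} (hA : A ∈ K.faces) :
    u + w ∉ A := by
  intro hmem
  have heq : Finsupp.single (u + w) (1 : ℝ) = Finsupp.single u 1 + Finsupp.single w 1 := by
    refine K.comb_injOn ⟨by simp, K.down_closed A hA _ ?_⟩
      ⟨add_nonneg (by simp) (by simp), K.down_closed _ h _ ?_⟩ (by simp [toNR_add])
    · exact Finsupp.support_single_subset.trans (Finset.singleton_subset_iff.2 hmem)
    · exact Finsupp.support_add.trans (Finset.union_subset_union Finsupp.support_single_subset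
        Finsupp.support_single_subset)
  have := DFunLike.congr_fun heq (u + w)
  rw [Finsupp.add_apply, Finsupp.single_eq_same, Finsupp.single_eq_of_ne (K.add_ne_left h),
    Finsupp.single_eq_of_ne (K.add_ne_right h)] at this
  norm_num at this

theorem starFaces_finite (u w : N) : (K.starFaces u w).Finite := by
  refine (K.finite.union (K.finite.image (insert (u + w)))).subset ?_
  rintro A ⟨-, hA | ⟨he, hA⟩⟩
  · exact Or.inl hA
  · exact Or.inr ⟨A.erase (u + w), K.down_closed _ hA _ Finset.subset_union_left,
      Finset.insert_erase he⟩

theorem starFaces_down_closed {A B : Finset N} (hA : A ∈ K.starFaces u w) (hB : B ⊆ A) :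
    B ∈ K.starFaces u w := by
  obtain ⟨hsub, hA⟩ := hA
  refine ⟨fun h => hsub (h.trans hB), ?_⟩
  obtain hA | ⟨-, hA⟩ := hA
  · exact Or.inl (K.down_closed A hA B hB)
  by_cases heB : u + w ∈ B
  · exact Or.inr ⟨heB, K.down_closed _ hA _
      (Finset.union_subset_union_left (Finset.erase_subset_erase _ hB))⟩
  · refine Or.inl (K.down_closed _ hA _ fun x hx => Finset.mem_union_left _
      (Finset.mem_erase.2 ⟨?_, hB hx⟩))
    rintro rfl
    exact heB hx

theorem isUnimodular_of_mem_starFaces (hne : u ≠ w) {A : Finset N} (hA : A ∈ K.starFaces u w) :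
    IsUnimodular A := by
  obtain ⟨hsub, hA | ⟨-, hA⟩⟩ := hA
  · exact K.unimodular A hA
  have hF := K.unimodular _ hA
  by_cases hu : u ∈ A
  · have hw : w ∉ A := fun hw => hsub (Finset.insert_subset hu (Finset.singleton_subset_iff.2 hw))
    refine (hF.insert_add_erase (u := w) (w := u) (by simp) (by simp) hne.symm).mono fun x hx => ?_
    have hxw : x ≠ w := fun h => hw (h ▸ hx)
    by_cases hxe : x = u + w
    · simp [hxe, add_comm]
    · simp [hx, hxw, hxe]
  · refine (hF.insert_add_erase (u := u) (w := w) (by simp) (by simp) hne).mono fun x hx => ?_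
    have hxu : x ≠ u := fun h => hu (h ▸ hx)
    by_cases hxe : x = u + w
    · simp [hxe]
    · simp [hx, hxu, hxe]

theorem support_collapse_mem {R : Type*} [AddCommGroup R] (h : {u, w} ∈ K.faces) {c : N →₀ R}
    (hc : c.support ∈ K.starFaces u w) : (collapse u w c).support ∈ K.faces := by
  obtain ⟨-, hc | hc⟩ := hc
  · rwa [collapse_eq_self (Finsupp.notMem_support_iff.1 (K.add_notMem_of_mem_faces h hc))]
  · exact K.down_closed _ hc.2 _ (support_collapse_subset c)

theorem support_expand_mem {R : Type*} [AddCommGroup R] [LinearOrder R] (hne : u ≠ w)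
    (h : {u, w} ∈ K.faces) {c : N →₀ R} (hc : 0 ≤ c) (hcK : c.support ∈ K.faces) :
    (expand u w c).support ∈ K.starFaces u w := by
  have hu := K.add_ne_left h
  have hw := K.add_ne_right h
  have hce : c (u + w) = 0 := Finsupp.notMem_support_iff.1 (K.add_notMem_of_mem_faces h hcK)
  refine ⟨fun hsub => ?_, ?_⟩
  · simp only [Finset.insert_subset_iff, Finset.singleton_subset_iff, Finsupp.mem_support_iff,
      expand_apply_left hne hu, expand_apply_right hne hw] at hsub
    obtain hmin | hmin := min_choice (c u) (c w)
    · exact hsub.1 (by rw [hmin, sub_self])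
    · exact hsub.2 (by rw [hmin, sub_self])
  obtain hmin | hmin := (le_min (hc u) (hc w) : 0 ≤ min (c u) (c w)).eq_or_lt
  · left
    have : expand u w c = c := by simp [expand, ← hmin]
    rwa [this]
  · right
    refine ⟨?_, K.down_closed _ hcK _ fun x hx => ?_⟩
    · rw [Finsupp.mem_support_iff, expand_apply_add hu hw, hce, zero_add]
      exact hmin.ne'
    rw [Finsupp.mem_support_iff]
    by_cases hxu : x = u
    · exact hxu ▸ (hmin.trans_le (min_le_left _ _)).ne'
    by_cases hxw : x = w
    · exact hxw ▸ (hmin.trans_le (min_le_right _ _)).ne'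
    simp only [Finset.mem_union, Finset.mem_erase, Finset.mem_insert, Finset.mem_singleton, hxu,
      hxw, or_false] at hx
    simpa [expand_apply_of_ne hxu hxw hx.1] using hx.2

/-- The star subdivision at the two-dimensional cone spanned by `u` and `w`, with new ray
generator `u + w`. -/
def star (u w : N) (hne : u ≠ w) (h : {u, w} ∈ K.faces) : SmoothComplex N where
  faces := K.starFaces u w
  finite := K.starFaces_finite u w
  empty_mem := ⟨fun hsub => by simpa using hsub (Finset.mem_insert_self u {w}), Or.inl K.empty_mem⟩
  down_closed _ hA _ hB := K.starFaces_down_closed hA hB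
  unimodular _ hA := K.isUnimodular_of_mem_starFaces hne hA
  comb_injOn := by
    rintro c ⟨hc, hcs⟩ d ⟨hd, hds⟩ hcd
    have hcollapse : collapse u w c = collapse u w d :=
      K.comb_injOn ⟨collapse_nonneg hc, K.support_collapse_mem h hcs⟩
        ⟨collapse_nonneg hd, K.support_collapse_mem h hds⟩
        (by rw [comb_collapse, comb_collapse, hcd])
    have hzero : ∀ {c : N →₀ ℝ}, c.support ∈ K.starFaces u w → c u = 0 ∨ c w = 0 := by
      intro c hc
      by_contra! hcon
      exact hc.1 (by simpa [Finset.insert_subset_iff] using hcon)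
    rw [← expand_collapse hne (K.add_ne_left h) (K.add_ne_right h) hc (hzero hcs), hcollapse,
      expand_collapse hne (K.add_ne_left h) (K.add_ne_right h) hd (hzero hds)]

theorem star_isSubdivision (hne : u ≠ w) (h : {u, w} ∈ K.faces) :
    (K.star u w hne h).toFan.IsSubdivision K.toFan := by
  refine ⟨Set.ext fun x => ?_, ?_⟩
  · rw [mem_support_toFan, mem_support_toFan]
    constructor
    · rintro ⟨c, hc, hcs, rfl⟩
      exact ⟨collapse u w c, collapse_nonneg hc, K.support_collapse_mem h hcs, comb_collapse c⟩
    · rintro ⟨c, hc, hcs, rfl⟩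
      exact ⟨expand u w c, expand_nonneg hne (K.add_ne_left h) (K.add_ne_right h) hc,
        K.support_expand_mem hne h hc hcs, linearCombination_expand (toNR_add u w) c⟩
  · rintro _ ⟨A, ⟨-, hA | ⟨-, hA⟩⟩, rfl⟩
    · exact ⟨coneOf A, coneOf_mem_toFan hA, le_rfl⟩
    · refine ⟨_, coneOf_mem_toFan hA, coneOf_le.2 fun v hv => ?_⟩
      by_cases hve : v = u + w
      · rw [hve, toNR_add]
        exact add_mem (toNR_mem_coneOf (by simp)) (toNR_mem_coneOf (by simp))
      · exact toNR_mem_coneOf (by simp [hv, hve])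

end Star

section Refinement

variable {N : Type*} [AddCommGroup N]

/-! ### Subdivisions with a prescribed ray -/

theorem exists_int_combination (K : SmoothComplex N) {v : N} (hv : toNR v ∈ K.toFan.support) :
    ∃ c : N →₀ ℤ, 0 ≤ c ∧ c.support ∈ K.faces ∧ Finsupp.linearCombination ℤ id c = v := by
  classical
  obtain ⟨_, ⟨A, hA, rfl⟩, hvA⟩ := Fan.mem_support.1 hv
  obtain ⟨b, hb⟩ := K.unimodular A hA
  have hcoord := (toNR_mem_coneOf_iff b hb).1 hvA
  refine ⟨(b.repr v).mapDomain b, ?_, K.down_closed A hA _ fun x hx => ?_, ?_⟩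
  · exact Finset.sum_nonneg fun i _ => Finsupp.single_nonneg.2 (hcoord i).1
  · obtain ⟨i, hi, rfl⟩ := Finset.mem_image.1 (Finsupp.mapDomain_support hx)
    by_contra hiA
    exact Finsupp.mem_support_iff.1 hi ((hcoord i).2 hiA)
  · rw [Finsupp.linearCombination_mapDomain, Function.id_comp, b.linearCombination_repr]

theorem exists_subdivision_vertex_of_combination [Module.Free ℤ N] {v : N} (hv : IsPrimitive v)
    (K : SmoothComplex N) {c : N →₀ ℤ} (hc : 0 ≤ c) (hcK : c.support ∈ K.faces)
    (hcv : Finsupp.linearCombination ℤ id c = v) :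
    ∃ K' : SmoothComplex N, K'.toFan.IsSubdivision K.toFan ∧ {v} ∈ K'.faces := by
  classical
  induction hn : c.degree.toNat using Nat.strong_induction_on generalizing K c with
  | _ n ih =>
  have hc0 : c ≠ 0 := by
    rintro rfl
    exact hv.ne_zero (by simpa using hcv.symm)
  obtain ⟨a, ha⟩ := Finsupp.support_nonempty_iff.2 hc0
  obtain hsupp | ⟨u, hu, w, hw, hne⟩ := Finset.eq_singleton_or_nontrivial ha
  · have hva : v = a := by
      rw [hsupp] at hcK
      refine hv.eq_of_toNR_mem_ray (K.unimodular _ hcK) (mem_ray.2 ⟨c a, mod_cast hc a, ?_⟩)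
      rw [← hcv, Finsupp.linearCombination_apply, Finsupp.sum, hsupp, Finset.sum_singleton,
        toNR_zsmul, id]
    exact ⟨K, .refl _, by rwa [hva, ← hsupp]⟩
  · have huw := K.pair_mem hcK hu hw
    have hexpand := expand_nonneg hne (K.add_ne_left huw) (K.add_ne_right huw) hc
    have hmin : 0 < min (c u) (c w) := lt_min
      (lt_of_le_of_ne (hc u) (Finsupp.mem_support_iff.1 hu).symm)
      (lt_of_le_of_ne (hc w) (Finsupp.mem_support_iff.1 hw).symm)
    have hdegree : (expand u w c).degree.toNat < n := by
      have : 0 ≤ (expand u w c).degree := Finset.sum_nonneg fun x _ => hexpand x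
      have := degree_expand (u := u) (w := w) c
      omega
    obtain ⟨K', hK', hvK'⟩ := ih _ hdegree (K.star u w hne huw) hexpand
      (K.support_expand_mem hne huw hc hcK) ((linearCombination_expand rfl c).trans hcv) rfl
    exact ⟨K', hK'.trans (K.star_isSubdivision hne huw), hvK'⟩

theorem exists_subdivision_vertex [Module.Free ℤ N] (K : SmoothComplex N) {v : N}
    (hv : IsPrimitive v) (hvK : toNR v ∈ K.toFan.support) :
    ∃ K' : SmoothComplex N, K'.toFan.IsSubdivision K.toFan ∧ {v} ∈ K'.faces := by
  obtain ⟨c, hc, hcK, hcv⟩ := K.exists_int_combination hvK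
  exact exists_subdivision_vertex_of_combination hv K hc hcK hcv

/-! ### Subdivisions along hyperplanes and common refinements -/

/-- The linear form `m` does not change sign on any cone, i.e. the fan refines the subdivision of
`N_ℝ` by the hyperplane `m = 0`. -/
def SignConstant (K : SmoothComplex N) (m : DualLattice N) : Prop :=
  ∀ A ∈ K.faces, (∀ a ∈ A, 0 ≤ m a) ∨ (∀ a ∈ A, m a ≤ 0)

/-- The two-dimensional cones, spanned by `p.1` and `p.2`, on which the linear form `m` changes
sign. -/
def signChanges (K : SmoothComplex N) (m : DualLattice N) : Set (N × N) :=
  {p | (∃ A ∈ K.faces, p.1 ∈ A ∧ p.2 ∈ A) ∧ 0 < m p.1 ∧ m p.2 < 0}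

theorem finite_signChanges (K : SmoothComplex N) (m : DualLattice N) :
    (K.signChanges m).Finite := by
  have hvertices : (⋃ A ∈ K.faces, (A : Set N)).Finite :=
    K.finite.biUnion fun A _ => A.finite_toSet
  refine (hvertices.prod hvertices).subset ?_
  rintro p ⟨⟨A, hA, hu, hw⟩, -⟩
  exact ⟨Set.mem_biUnion hA hu, Set.mem_biUnion hA hw⟩

theorem signConstant_of_signChanges_eq_empty {K : SmoothComplex N} {m : DualLattice N}
    (h : K.signChanges m = ∅) : K.SignConstant m := by
  intro A hA
  by_contra! hcon
  obtain ⟨⟨a, ha, hma⟩, b, hb, hmb⟩ := hcon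
  exact Set.eq_empty_iff_forall_notMem.1 h (b, a) ⟨⟨A, hA, hb, ha⟩, hmb, hma⟩

theorem SignConstant.of_isSubdivision {K K' : SmoothComplex N} {m : DualLattice N}
    (h : K.SignConstant m) (hK : K'.toFan.IsSubdivision K.toFan) : K'.SignConstant m := by
  intro A' hA'
  obtain ⟨_, ⟨A, hA, rfl⟩, hle⟩ := hK.2 _ (coneOf_mem_toFan hA')
  have hmono : ∀ {m : DualLattice N}, (∀ a ∈ A, 0 ≤ m a) → ∀ a ∈ A', 0 ≤ m a := fun hm =>
    mem_dualPoints_coneOf.1 fun x hx => mem_dualPoints_coneOf.2 hm x (hle hx)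
  refine (h A hA).imp hmono fun hneg a ha => ?_
  simpa using hmono (m := -m) (by simpa using hneg) a ha

theorem SignConstant.nonneg_of_sum_nonneg {K : SmoothComplex N} {m : DualLattice N}
    (h : K.SignConstant m) {A : Finset N} (hA : A ∈ K.faces) (hsum : 0 ≤ m (∑ v ∈ A, v)) :
    ∀ v ∈ A, 0 ≤ m v ∧ (m (∑ v ∈ A, v) = 0 → m v = 0) := by
  intro v hv
  rw [map_sum] at hsum ⊢
  obtain hpos | hneg := h A hA
  · exact ⟨hpos v hv, fun h0 => (Finset.sum_eq_zero_iff_of_nonneg hpos).1 h0 v hv⟩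
  · have hmv := (Finset.sum_eq_zero_iff_of_nonpos hneg).1
      (le_antisymm (Finset.sum_nonpos hneg) hsum) v hv
    exact ⟨hmv.ge, fun _ => hmv⟩

theorem mem_signChanges_of_star [DecidableEq N] {K : SmoothComplex N} {m : DualLattice N} {n : ℤ}
    (hgap : ∀ p ∈ K.signChanges m, m p.1 - m p.2 ≤ n + 1) {u w : N} (hne : u ≠ w)
    (h : {u, w} ∈ K.faces) (hu : 0 < m u) (hw : m w < 0) {q : N × N}
    (hq : q ∈ (K.star u w hne h).signChanges m) :
    (q ∈ K.signChanges m ∧ q ≠ (u, w)) ∨ m q.1 - m q.2 ≤ n := by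
  obtain ⟨x, y⟩ := q
  obtain ⟨⟨A, ⟨hsub, hA | ⟨-, hA⟩⟩, hxA, hyA⟩, hx, hy⟩ := hq
  · refine Or.inl ⟨⟨⟨A, hA, hxA, hyA⟩, hx, hy⟩, ?_⟩
    rintro ⟨⟩
    exact hsub (Finset.insert_subset hxA (Finset.singleton_subset_iff.2 hyA))
  dsimp only at hxA hyA hx hy ⊢
  have hmadd := map_add m u w
  by_cases hxe : x = u + w
  · have hye : y ≠ u + w := by rintro rfl; rw [hxe] at hx; omega
    have := hgap (u, y) ⟨⟨_, hA, by simp, by simp [hye, hyA]⟩, hu, hy⟩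
    rw [hxe]
    grind
  by_cases hye : y = u + w
  · have := hgap (x, w) ⟨⟨_, hA, by simp [hxe, hxA], by simp⟩, hx, hw⟩
    rw [hye]
    grind
  by_cases hxy : x = u ∧ y = w
  · exact absurd (by simp [Finset.insert_subset_iff, hxy.1 ▸ hxA, hxy.2 ▸ hyA]) hsub
  · exact Or.inl ⟨⟨⟨_, hA, by simp [hxe, hxA], by simp [hye, hyA]⟩, hx, hy⟩, by simpa using hxy⟩

-- Starring an edge of maximal gap removes it and creates only sign changes of smaller gap.
theorem exists_subdivision_gap_le (m : DualLattice N) (n : ℤ) (K : SmoothComplex N)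
    (hgap : ∀ p ∈ K.signChanges m, m p.1 - m p.2 ≤ n + 1) :
    ∃ K' : SmoothComplex N, K'.toFan.IsSubdivision K.toFan ∧
      ∀ p ∈ K'.signChanges m, m p.1 - m p.2 ≤ n := by
  classical
  induction hj : {p ∈ K.signChanges m | m p.1 - m p.2 = n + 1}.ncard
    using Nat.strong_induction_on generalizing K with
  | _ j ih =>
  by_cases hmax : ∃ p ∈ K.signChanges m, m p.1 - m p.2 = n + 1
  · obtain ⟨⟨u, w⟩, huw, heq⟩ := hmax
    obtain ⟨⟨A, hA, huA, hwA⟩, hu, hw⟩ := id huw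
    dsimp only at huA hwA hu hw heq
    have hne : u ≠ w := by rintro rfl; omega
    have hedge := K.pair_mem hA huA hwA
    have hstar := fun q => mem_signChanges_of_star hgap hne hedge hu hw (q := q)
    have hlt : {p ∈ (K.star u w hne hedge).signChanges m | m p.1 - m p.2 = n + 1}.ncard < j := by
      rw [← hj]
      refine Set.ncard_lt_ncard ⟨fun q hq => ?_, fun hsub => ?_⟩
        ((K.finite_signChanges m).subset fun p hp => hp.1)
      · obtain hq' | hq' := hstar q hq.1
        · exact ⟨hq'.1, hq.2⟩
        · have := hq.2
          omega
      · obtain huw' | huw' := hstar (u, w) (hsub ⟨huw, heq⟩).1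
        · exact huw'.2 rfl
        · dsimp only at huw'
          omega
    obtain ⟨K', hK', hgap'⟩ := ih _ hlt _ (fun q hq => (hstar q hq).elim
      (fun h => hgap q h.1) fun h => by omega) rfl
    exact ⟨K', hK'.trans (K.star_isSubdivision hne hedge), hgap'⟩
  · push Not at hmax
    exact ⟨K, .refl _, fun p hp => by have := hgap p hp; have := hmax p hp; omega⟩

theorem exists_subdivision_signChanges_eq_empty (m : DualLattice N) (n : ℕ) (K : SmoothComplex N)
    (hgap : ∀ p ∈ K.signChanges m, m p.1 - m p.2 ≤ n) :
    ∃ K' : SmoothComplex N, K'.toFan.IsSubdivision K.toFan ∧ K'.signChanges m = ∅ := by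
  induction n generalizing K with
  | zero =>
    refine ⟨K, .refl _, Set.eq_empty_of_forall_notMem fun p hp => ?_⟩
    have := hgap p hp
    have := hp.2
    omega
  | succ n ih =>
    obtain ⟨K₁, hK₁, hgap₁⟩ := exists_subdivision_gap_le m n K (by exact_mod_cast hgap)
    obtain ⟨K₂, hK₂, hempty⟩ := ih K₁ hgap₁
    exact ⟨K₂, hK₂.trans hK₁, hempty⟩

theorem exists_subdivision_signConstant (K : SmoothComplex N) (m : DualLattice N) :
    ∃ K' : SmoothComplex N, K'.toFan.IsSubdivision K.toFan ∧ K'.SignConstant m := by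
  obtain ⟨B, hB⟩ := ((K.finite_signChanges m).image fun p => m p.1 - m p.2).bddAbove
  obtain ⟨K', h, hempty⟩ := exists_subdivision_signChanges_eq_empty m B.toNat K fun p hp =>
    (hB ⟨p, hp, rfl⟩).trans (Int.self_le_toNat B)
  exact ⟨K', h, signConstant_of_signChanges_eq_empty hempty⟩

theorem exists_subdivision_forall_signConstant (K : SmoothComplex N)
    {s : Set (DualLattice N)} (hs : s.Finite) :
    ∃ K' : SmoothComplex N, K'.toFan.IsSubdivision K.toFan ∧ ∀ m ∈ s, K'.SignConstant m := by
  induction s, hs using Set.Finite.induction_on with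
  | empty => exact ⟨K, .refl _, by simp⟩
  | insert _ _ ih =>
    obtain ⟨K₁, h₁, hs⟩ := ih
    obtain ⟨K₂, h₂, hm⟩ := K₁.exists_subdivision_signConstant _
    refine ⟨K₂, h₂.trans h₁, Set.forall_mem_insert.2 ⟨hm, fun m' hm' => ?_⟩⟩
    exact (hs m' hm').of_isSubdivision h₂

theorem exists_common_subdivision (K L : SmoothComplex N)
    (h : K.toFan.support = L.toFan.support) :
    ∃ K' : SmoothComplex N, K'.toFan.IsSubdivision K.toFan ∧ K'.toFan.IsSubdivision L.toFan := by
  have : Nonempty (Module.Basis (Fin (Module.finrank ℤ N)) ℤ N) :=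
    ⟨(L.unimodular ∅ L.empty_mem).choose⟩
  choose! b hb using L.unimodular
  have hfin : (⋃ A ∈ L.faces, Set.range fun i => (b A).coord i).Finite :=
    L.finite.biUnion fun A _ => Set.finite_range _
  obtain ⟨K', hK', hsign⟩ := K.exists_subdivision_forall_signConstant hfin
  refine ⟨K', hK', hK'.1.trans h, ?_⟩
  rintro _ ⟨B, hB, rfl⟩
  -- A cone of `L` through the interior point `∑ v ∈ B, v` of `coneOf B` contains all of `coneOf B`.
  have hsum : toNR (∑ v ∈ B, v) ∈ coneOf B := by
    rw [toNR_sum]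
    exact sum_mem fun v hv => toNR_mem_coneOf hv
  obtain ⟨_, ⟨A, hA, rfl⟩, hsumA⟩ := Fan.mem_support.1 <| h ▸ hK'.1 ▸
    Fan.mem_support.2 ⟨_, coneOf_mem_toFan hB, hsum⟩
  refine ⟨_, coneOf_mem_toFan hA, coneOf_le.2 fun v hv => (toNR_mem_coneOf_iff _ (hb A hA)).2
    fun i => ?_⟩
  have hcoord := (toNR_mem_coneOf_iff _ (hb A hA)).1 hsumA i
  obtain ⟨hpos, hzero⟩ :=
    (hsign _ (Set.mem_biUnion hA ⟨i, rfl⟩)).nonneg_of_sum_nonneg hB hcoord.1 v hv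
  exact ⟨hpos, fun hi => hzero (hcoord.2 hi)⟩

end Refinement

end SmoothComplex

/-! ### The function associated with a toric b-divisor -/

section Phi

variable {N : Type*} [AddCommGroup N]

theorem Fan.zero_mem_support {S : Fan N} (h : S.cones.Nonempty) : (0 : NR N) ∈ S.support :=
  let ⟨σ, hσ⟩ := h
  Fan.mem_support.2 ⟨σ, hσ, zero_mem σ⟩

theorem Fan.IsSubdivision.nonempty {S' S : Fan N} (h : S'.IsSubdivision S)
    (hne : S.cones.Nonempty) : S'.cones.Nonempty :=
  let ⟨σ, hσ, _⟩ := Fan.mem_support.1 (h.1 ▸ Fan.zero_mem_support hne)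
  ⟨σ, hσ⟩

theorem Fan.toNR_mem_support_of_mem_rays {S : Fan N} {v : N} (hv : v ∈ S.rays) :
    toNR v ∈ S.support :=
  Fan.mem_support.2 ⟨ray v, hv.2, PointedCone.subset_hull rfl⟩

variable [Module.Free ℤ N]

theorem Fan.exists_toFan_eq_of_R {S : Fan N} (hne : S.cones.Nonempty) (S' : S.R) :
    ∃ K : SmoothComplex N, K.toFan = S'.1 :=
  SmoothComplex.exists_toFan_eq S'.2.1 (S'.2.2.nonempty hne)

theorem Fan.exists_mem_rays {S : Fan N} (hsmooth : S.IsSmooth) (hne : S.cones.Nonempty) {v : N}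
    (hv : IsPrimitive v) (hvS : toNR v ∈ S.support) : ∃ S' : S.R, v ∈ S'.1.rays := by
  obtain ⟨K, rfl⟩ := SmoothComplex.exists_toFan_eq hsmooth hne
  obtain ⟨K', hK', hvK'⟩ := K.exists_subdivision_vertex hv hvS
  exact ⟨⟨K'.toFan, K'.isSmooth_toFan, hK'⟩, K'.mem_rays_toFan.2 hvK'⟩

theorem SmoothComplex.mem_rays_of_isSubdivision {K K' : SmoothComplex N}
    (h : K'.toFan.IsSubdivision K.toFan) {v : N} (hv : v ∈ K.toFan.rays) : v ∈ K'.toFan.rays := by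
  have hvK : {v} ∈ K.faces := K.mem_rays_toFan.1 hv
  obtain ⟨c, hc, hcs, hcv⟩ :=
    K'.mem_support_toFan.1 (h.1 ▸ Fan.toNR_mem_support_of_mem_rays hv)
  obtain ⟨_, ⟨A, hA, rfl⟩, hle⟩ := h.2 _ (coneOf_mem_toFan hcs)
  have hface := (K.toFan.inter_isFaceOf _ (coneOf_mem_toFan hA) _ (coneOf_mem_toFan hvK)).1
  have hv_mem : toNR v ∈ coneOf {v} := toNR_mem_coneOf (Finset.mem_singleton_self v)
  have hcv_mem : comb N c ∈ coneOf c.support := mem_coneOf.2 ⟨c, hc, subset_rfl, rfl⟩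
  have hsub : ∀ a ∈ c.support, toNR a ∈ coneOf {v} := fun a ha =>
    (toNR_mem_of_comb_mem hface hc (fun w hw => hle (toNR_mem_coneOf hw))
      ⟨hle hcv_mem, hcv ▸ hv_mem⟩ ha).2
  have heq : coneOf c.support = coneOf {v} :=
    le_antisymm (coneOf_le.2 hsub) <|
      coneOf_le.2 fun w hw => Finset.mem_singleton.1 hw ▸ hcv ▸ hcv_mem
  exact K'.mem_rays_toFan.2 <|
    (K'.unimodular _ hcs).coneOf_injective (K.unimodular _ hvK) heq ▸ hcs

namespace ToricBDivisor

variable {S : Fan N} (hne : S.cones.Nonempty) (D : ToricBDivisor S)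
include hne

theorem inc_eq_of_isSubdivision {S' S'' : S.R} (h : S''.1.IsSubdivision S'.1) {v : N}
    (hv : v ∈ S'.1.rays) : ∃ hv' : v ∈ S''.1.rays, D.inc S'' ⟨v, hv'⟩ = D.inc S' ⟨v, hv⟩ := by
  have hv' : v ∈ S''.1.rays := by
    obtain ⟨K, hK⟩ := Fan.exists_toFan_eq_of_R hne S'
    obtain ⟨K', hK'⟩ := Fan.exists_toFan_eq_of_R hne S''
    rw [← hK, ← hK'] at h
    rw [← hK] at hv
    exact hK' ▸ SmoothComplex.mem_rays_of_isSubdivision h hv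
  exact ⟨hv', by rw [← D.compat S'' S' h, Fan.pushforward, dif_pos hv']⟩

theorem inc_eq_inc (S₁ S₂ : S.R) {v : N} (hv₁ : v ∈ S₁.1.rays) (hv₂ : v ∈ S₂.1.rays) :
    D.inc S₁ ⟨v, hv₁⟩ = D.inc S₂ ⟨v, hv₂⟩ := by
  obtain ⟨K₁, hK₁⟩ := Fan.exists_toFan_eq_of_R hne S₁
  obtain ⟨K₂, hK₂⟩ := Fan.exists_toFan_eq_of_R hne S₂
  obtain ⟨K, h₁, h₂⟩ := K₁.exists_common_subdivision K₂ (by rw [hK₁, hK₂, S₁.2.2.1, S₂.2.2.1])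
  rw [hK₁] at h₁
  rw [hK₂] at h₂
  let S₃ : S.R := ⟨K.toFan, K.isSmooth_toFan, h₁.trans S₁.2.2⟩
  obtain ⟨_, e₁⟩ := D.inc_eq_of_isSubdivision hne (S'' := S₃) h₁ hv₁
  obtain ⟨_, e₂⟩ := D.inc_eq_of_isSubdivision hne (S'' := S₃) h₂ hv₂
  rw [← e₁, ← e₂]

theorem phi_eq_neg_inc (S' : S.R) {v : N} (hv : v ∈ S'.1.rays) :
    D.phi v = -D.inc S' ⟨v, hv⟩ := by
  have h : ∃ S' : S.R, v ∈ S'.1.rays := ⟨S', hv⟩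
  rw [phi, dif_pos h, D.inc_eq_inc hne _ S' h.choose_spec hv]

theorem Delta_eq (hsmooth : S.IsSmooth) :
    D.Delta = {m : MR N | ∀ v : N, IsPrimitive v → toNR v ∈ S.support →
      (D.phi v : ℝ) ≤ pairing N m (toNR v)} := by
  ext m
  simp only [Delta, Set.mem_iInter, Fan.polyhedron, Set.mem_ofPred_eq]
  constructor
  · intro h v hv hvS
    obtain ⟨S', hS'⟩ := Fan.exists_mem_rays hsmooth hne hv hvS
    rw [D.phi_eq_neg_inc hne S' hS']
    exact_mod_cast h S' ⟨v, hS'⟩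
  · intro h S' v
    have := h v v.2.1 (S'.2.2.1 ▸ Fan.toNR_mem_support_of_mem_rays v.2)
    rw [D.phi_eq_neg_inc hne S' v.2] at this
    exact_mod_cast this

end ToricBDivisor

end Phi

/-! ### Supports in group algebras -/

section GroupAlgebra

open AddMonoidAlgebra

variable {R G : Type*}

theorem single_mem_supported [Semiring R] {T : Set G} {g : G} (hg : g ∈ T) (r : R) :
    single g r ∈ supported R R T := by
  intro g' hg'
  rwa [Finset.mem_singleton.1 (Finsupp.support_single_subset hg')]

theorem mul_mem_supported [Semiring R] [Add G] {T T' T'' : Set G} {a b : AddMonoidAlgebra R G}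
    (ha : a ∈ supported R R T) (hb : b ∈ supported R R T')
    (hadd : ∀ g ∈ T, ∀ g' ∈ T', g + g' ∈ T'') : a * b ∈ supported R R T'' := by
  classical
  intro g hg
  obtain ⟨x, hx, y, hy, rfl⟩ := Finset.mem_add.1 (support_coeff_mul_subset a b hg)
  exact hadd x (ha hx) y (hb hy)

theorem single_mul_mem_supported [Semiring R] [Add G] {T : Set G} {g : G} {r : R}
    {a : AddMonoidAlgebra R G} (h : ∀ x ∈ a.coeff.support, g + x ∈ T) :
    single g r * a ∈ supported R R T := by
  have ha : a ∈ supported R R (a.coeff.support : Set G) := fun _ hx => hx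
  exact mul_mem_supported (single_mem_supported (Set.mem_singleton g) r) ha
    (by rintro _ rfl; exact h)

theorem single_mul_single_neg_mul [Semiring R] [AddGroup G] (g : G) (a : AddMonoidAlgebra R G) :
    single g 1 * (single (-g) 1 * a) = a := by
  rw [← mul_assoc, single_mul_single, add_neg_cancel, mul_one, ← one_def, one_mul]

theorem exists_add_of_mem_supported_union [Semiring R] {T T' : Set G} {a : AddMonoidAlgebra R G}
    (ha : a ∈ supported R R (T ∪ T')) :
    ∃ a₀ ∈ supported R R T, ∃ a₁ ∈ supported R R T', a = a₀ + a₁ := by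
  rw [supported_eq_span_single, Set.image_union, Submodule.span_union, ← supported_eq_span_single,
    ← supported_eq_span_single] at ha
  obtain ⟨a₀, h₀, a₁, h₁, h⟩ := Submodule.mem_sup.1 ha
  exact ⟨a₀, h₀, a₁, h₁, h.symm⟩

theorem eq_zero_of_mem_supported_of_disjoint [Semiring R] {T T' : Set G} {a : AddMonoidAlgebra R G}
    (ha : a ∈ supported R R T) (ha' : a ∈ supported R R T') (hT : Disjoint T T') : a = 0 := by
  rw [← coeff_eq_zero, ← Finsupp.support_eq_empty]
  exact Finset.eq_empty_of_forall_notMem fun g hg => Set.disjoint_left.1 hT (ha hg) (ha' hg)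

variable [Ring R] [AddCommMonoid G] [NoZeroDivisors (AddMonoidAlgebra R G)]

/-- The lowest part of a product is the product of the lowest parts. -/
theorem mem_supported_pos_or_of_mul_mem (d : G →+ ℤ) {a b : AddMonoidAlgebra R G}
    (ha : a ∈ supported R R {g | 0 ≤ d g}) (hb : b ∈ supported R R {g | 0 ≤ d g})
    (hab : a * b ∈ supported R R {g | 0 < d g}) :
    a ∈ supported R R {g | 0 < d g} ∨ b ∈ supported R R {g | 0 < d g} := by
  have hsplit : {g | 0 ≤ d g} = {g | d g = 0} ∪ {g | 0 < d g} := by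
    ext g
    simp only [Set.mem_ofPred_eq, Set.mem_union]
    lia
  obtain ⟨a₀, ha₀, a₁, ha₁, rfl⟩ := exists_add_of_mem_supported_union (hsplit ▸ ha)
  obtain ⟨b₀, hb₀, b₁, hb₁, rfl⟩ := exists_add_of_mem_supported_union (hsplit ▸ hb)
  have h01 : a₀ * b₁ ∈ supported R R {g | 0 < d g} := mul_mem_supported ha₀ hb₁
    fun g hg g' hg' => by simp only [Set.mem_ofPred_eq, map_add] at *; lia
  have h1 : a₁ * (b₀ + b₁) ∈ supported R R {g | 0 < d g} := mul_mem_supported ha₁ hb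
    fun g hg g' hg' => by simp only [Set.mem_ofPred_eq, map_add] at *; lia
  have hlow : a₀ * b₀ = 0 := by
    refine eq_zero_of_mem_supported_of_disjoint (T := {g | d g = 0}) (T' := {g | 0 < d g})
      (mul_mem_supported ha₀ hb₀ ?_) ?_ ?_
    · intro g hg g' hg'
      simp only [Set.mem_ofPred_eq, map_add] at *
      lia
    · have : a₀ * b₀ = (a₀ + a₁) * (b₀ + b₁) - a₁ * (b₀ + b₁) - a₀ * b₁ := by noncomm_ring
      rw [this]
      exact sub_mem (sub_mem hab h1) h01
    · exact Set.disjoint_left.2 fun g (hg : d g = 0) (hg' : 0 < d g) => hg'.ne' hg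
  rcases mul_eq_zero.1 hlow with rfl | rfl
  · exact .inl (by rwa [zero_add])
  · exact .inr (by rwa [zero_add])

end GroupAlgebra

/-! ### Characters and charts -/

section Charts

open AddMonoidAlgebra

variable {k : Type*} [Field k] {N : Type*} [AddCommGroup N]

/-- The inclusion of the coordinate ring `k[M]` of the torus into the function field. -/
def fromTorus (k : Type*) [Field k] (N : Type*) [AddCommGroup N] :
    AddMonoidAlgebra k (DualLattice N) →ₐ[k] FunctionField k N :=
  IsScalarTower.toAlgHom k _ _

theorem fromTorus_injective : Function.Injective (fromTorus k N) :=
  IsFractionRing.injective (AddMonoidAlgebra k (DualLattice N)) (FunctionField k N)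

theorem fromTorus_single_one (m : DualLattice N) : fromTorus k N (single m 1) = chi k m := rfl

theorem chi_zero : chi k (0 : DualLattice N) = 1 := map_one (fromTorus k N)

theorem chi_add (m m' : DualLattice N) : chi k (m + m') = chi k m * chi k m' := by
  simp only [← fromTorus_single_one, ← map_mul, single_mul_single, mul_one]

theorem chi_ne_zero (m : DualLattice N) : chi k m ≠ 0 :=
  (map_ne_zero_iff _ fromTorus_injective).2 (by simp)

theorem chi_neg (m : DualLattice N) : chi k (-m) = (chi k m)⁻¹ :=
  eq_inv_of_mul_eq_one_left (by rw [← chi_add, neg_add_cancel, chi_zero])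

theorem chi_nsmul (n : ℕ) (m : DualLattice N) : chi k (n • m) = chi k m ^ n := by
  induction n with
  | zero => simp [chi_zero]
  | succ n ih => rw [succ_nsmul, chi_add, ih, pow_succ]

theorem chi_zsmul (n : ℤ) (m : DualLattice N) : chi k (n • m) = chi k m ^ n := by
  cases n with
  | ofNat n => simp [chi_nsmul]
  | negSucc n => rw [negSucc_zsmul, chi_neg, chi_nsmul, zpow_negSucc]

theorem linearIndependent_chi : LinearIndependent k (chi k : DualLattice N → FunctionField k N) :=
  (basis (DualLattice N) k).linearIndependent.map' (fromTorus k N).toLinearMap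
    (LinearMap.ker_eq_bot.2 fromTorus_injective)

theorem mem_span_chi {T : Set (DualLattice N)} {x : FunctionField k N} :
    x ∈ Submodule.span k (chi k '' T) ↔ ∃ a ∈ supported k k T, fromTorus k N a = x := by
  rw [supported_eq_span_single]
  have : chi k '' T = (fromTorus k N).toLinearMap '' ((fun m => single m 1) '' T) := by
    rw [Set.image_image]
    rfl
  rw [this, Submodule.span_image]
  rfl

theorem fromTorus_mem_span_chi {T : Set (DualLattice N)} {a : AddMonoidAlgebra k (DualLattice N)} :
    fromTorus k N a ∈ Submodule.span k (chi k '' T) ↔ a ∈ supported k k T :=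
  mem_span_chi.trans
    ⟨fun ⟨_, hb, h⟩ => fromTorus_injective h ▸ hb, fun h => ⟨a, h, rfl⟩⟩

theorem chi_mem_of_mem_closure {O : Submonoid (FunctionField k N)} {G : Set (DualLattice N)}
    (hG : ∀ m ∈ G, chi k m ∈ O) {m : DualLattice N} (hm : m ∈ AddSubmonoid.closure G) :
    chi k m ∈ O := by
  refine AddSubmonoid.closure_induction (motive := fun m _ => chi k m ∈ O) hG ?_ ?_ hm
  · exact chi_zero (k := k) (N := N) ▸ O.one_mem
  · exact fun m m' _ _ h h' => chi_add (k := k) m m' ▸ O.mul_mem h h'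

theorem zero_mem_dualPoints (σ : PointedCone ℝ (NR N)) : (0 : DualLattice N) ∈ dualPoints σ :=
  fun x _ => by simp [toMR]

theorem add_mem_dualPoints {σ : PointedCone ℝ (NR N)} {m m' : DualLattice N}
    (h : m ∈ dualPoints σ) (h' : m' ∈ dualPoints σ) : m + m' ∈ dualPoints σ := fun x hx => by
  simpa only [toMR, TensorProduct.tmul_add, map_add, LinearMap.add_apply] using
    add_nonneg (h x hx) (h' x hx)

theorem apply_nonneg_of_mem_dualPoints {σ : PointedCone ℝ (NR N)} {m : DualLattice N} {v : N}
    (h : m ∈ dualPoints σ) (hv : toNR v ∈ σ) : 0 ≤ m v := by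
  simpa only [pairing_toMR_toNR, Int.cast_nonneg_iff] using h _ hv

theorem coe_chartRing (σ : PointedCone ℝ (NR N)) :
    (chartRing k σ : Set (FunctionField k N)) = Submodule.span k (chi k '' dualPoints σ) := by
  have hclosed : (Submonoid.closure (chi k '' dualPoints σ) : Set (FunctionField k N)) ⊆
      chi k '' dualPoints σ := by
    intro x hx
    refine Submonoid.closure_induction (motive := fun x _ => x ∈ chi k '' dualPoints σ)
      (fun _ h => h) ⟨0, zero_mem_dualPoints σ, chi_zero⟩ ?_ hx
    rintro _ _ - - ⟨m, hm, rfl⟩ ⟨m', hm', rfl⟩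
    exact ⟨m + m', add_mem_dualPoints hm hm', chi_add m m'⟩
  exact congrArg SetLike.coe
    (Algebra.adjoin_eq_span_of_subset k (hclosed.trans Submodule.subset_span))

theorem mem_chartRing {σ : PointedCone ℝ (NR N)} {x : FunctionField k N} :
    x ∈ chartRing k σ ↔ ∃ a ∈ supported k k (dualPoints σ), fromTorus k N a = x := by
  rw [← SetLike.mem_coe, coe_chartRing, SetLike.mem_coe, mem_span_chi]

theorem fromTorus_mem_chartRing {σ : PointedCone ℝ (NR N)}
    {a : AddMonoidAlgebra k (DualLattice N)} :
    fromTorus k N a ∈ chartRing k σ ↔ a ∈ supported k k (dualPoints σ) := by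
  rw [← SetLike.mem_coe, coe_chartRing, SetLike.mem_coe, fromTorus_mem_span_chi]

theorem chi_mem_chartRing {σ : PointedCone ℝ (NR N)} {m : DualLattice N}
    (hm : m ∈ dualPoints σ) : chi k m ∈ chartRing k σ :=
  fromTorus_mem_chartRing.2 (single_mem_supported hm 1)

/-- The ideal, in the chart of a cone `σ` containing `v`, of the functions vanishing along the
toric prime divisor of `v`. -/
def divisorIdeal (k : Type*) [Field k] (σ : PointedCone ℝ (NR N)) (v : N) (hv : toNR v ∈ σ) :
    Ideal (chartRing k σ) where
  __ := (Submodule.span k (chi k '' {m | 0 < m v})).toAddSubmonoid.comap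
    (chartRing k σ).subtype.toAddMonoidHom
  smul_mem' := by
    rintro ⟨x, hx⟩ ⟨y, hy⟩ hxy
    obtain ⟨a, ha, rfl⟩ := mem_chartRing.1 hx
    obtain ⟨b, hb, rfl⟩ := mem_span_chi.1 hxy
    refine mem_span_chi.2 ⟨a * b, mul_mem_supported ha hb fun m hm m' hm' => ?_, map_mul _ _ _⟩
    exact add_pos_of_nonneg_of_pos (apply_nonneg_of_mem_dualPoints hm hv) hm'

theorem mem_divisorIdeal {σ : PointedCone ℝ (NR N)} {v : N} {hv : toNR v ∈ σ} {x : chartRing k σ} :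
    x ∈ divisorIdeal k σ v hv ↔
      (x : FunctionField k N) ∈ Submodule.span k (chi k '' {m | 0 < m v}) :=
  Iff.rfl

theorem fromTorus_mem_divisorIdeal {σ : PointedCone ℝ (NR N)} {v : N} {hv : toNR v ∈ σ}
    {a : AddMonoidAlgebra k (DualLattice N)} (ha : fromTorus k N a ∈ chartRing k σ) :
    (⟨fromTorus k N a, ha⟩ : chartRing k σ) ∈ divisorIdeal k σ v hv ↔
      a ∈ supported k k {m | 0 < m v} :=
  mem_divisorIdeal.trans fromTorus_mem_span_chi

theorem chi_mem_divisorIdeal {σ : PointedCone ℝ (NR N)} {v : N} {hv : toNR v ∈ σ}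
    {m : DualLattice N} (hm : m ∈ dualPoints σ) :
    (⟨chi k m, chi_mem_chartRing hm⟩ : chartRing k σ) ∈ divisorIdeal k σ v hv ↔ 0 < m v := by
  refine (fromTorus_mem_divisorIdeal (chi_mem_chartRing hm)).trans ?_
  simp [mem_supported]

instance isPrime_divisorIdeal (σ : PointedCone ℝ (NR N)) (v : N) (hv : toNR v ∈ σ) :
    (divisorIdeal k σ v hv).IsPrime := by
  refine ⟨?_, ?_⟩
  · rw [Ideal.ne_top_iff_one]
    have : (1 : chartRing k σ) = ⟨chi k 0, chi_mem_chartRing (zero_mem_dualPoints σ)⟩ :=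
      Subtype.ext chi_zero.symm
    rw [this, chi_mem_divisorIdeal (zero_mem_dualPoints σ)]
    simp
  · rintro ⟨x, hx⟩ ⟨y, hy⟩ hxy
    obtain ⟨a, ha, rfl⟩ := mem_chartRing.1 hx
    obtain ⟨b, hb, rfl⟩ := mem_chartRing.1 hy
    have hnonneg : dualPoints σ ⊆ {m | 0 ≤ m v} :=
      fun m hm => apply_nonneg_of_mem_dualPoints hm hv
    have hab : a * b ∈ supported k k {m : DualLattice N | 0 < m v} :=
      fromTorus_mem_span_chi.1 (by rw [map_mul]; exact hxy)
    exact (mem_supported_pos_or_of_mul_mem (Module.Dual.eval ℤ N v).toAddMonoidHom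
      (supported_mono hnonneg ha) (supported_mono hnonneg hb) hab).imp
      (fromTorus_mem_divisorIdeal hx).2 (fromTorus_mem_divisorIdeal hy).2

theorem divisorIdeal_eq_span {A : Finset N} {v : N} (hv : toNR v ∈ coneOf A) {m₁ : DualLattice N}
    (hm₁ : m₁ ∈ dualPoints (coneOf A)) (h1 : m₁ v = 1) (h0 : ∀ w ∈ A, w ≠ v → m₁ w = 0) :
    divisorIdeal k (coneOf A) v hv = Ideal.span {⟨chi k m₁, chi_mem_chartRing hm₁⟩} := by
  refine le_antisymm ?_ ?_
  · rintro ⟨x, hx⟩ hxv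
    obtain ⟨a, ha, rfl⟩ := mem_chartRing.1 hx
    have ha' : single (-m₁) 1 * a ∈ supported k k (dualPoints (coneOf A)) := by
      refine single_mul_mem_supported fun m hm => mem_dualPoints_coneOf.2 fun w hw => ?_
      have hmv : 0 < m v := (fromTorus_mem_divisorIdeal hx).1 hxv hm
      have := mem_dualPoints_coneOf.1 (ha hm) w hw
      rw [LinearMap.add_apply, LinearMap.neg_apply]
      by_cases hwv : w = v
      · subst hwv
        lia
      · rwa [h0 w hw hwv, neg_zero, zero_add]
    refine Ideal.mem_span_singleton.2 ⟨⟨_, fromTorus_mem_chartRing.2 ha'⟩, Subtype.ext ?_⟩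
    change fromTorus k N a = fromTorus k N (single m₁ 1) * fromTorus k N (single (-m₁) 1 * a)
    rw [← map_mul, single_mul_single_neg_mul]
  · rw [Ideal.span_singleton_le_iff_mem, chi_mem_divisorIdeal hm₁, h1]
    exact one_pos

end Charts

/-! ### Orders along principal primes -/

section Order

variable {K : Type*} [Field K]

theorem ordAlong_div (O : Subring K) [IsNoetherianRing O] [Ring.KrullDimLE 1 O] {a b : O}
    (ha : a ≠ 0) (hb : b ≠ 0) :
    ordAlong O ((a : K) / b) = ((Ring.ord O a).toNat : ℤ) - ((Ring.ord O b).toNat : ℤ) := by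
  have h : ∃ p : O × O, p.2 ≠ 0 ∧ (a : K) / b = (p.1 : K) / (p.2 : K) := ⟨(a, b), hb, rfl⟩
  rw [ordAlong, dif_pos h]
  obtain ⟨hd, hcd⟩ := h.choose_spec
  generalize h.choose.1 = c at *
  generalize h.choose.2 = d at *
  have hcross : a * d = c * b := by
    rw [div_eq_div_iff (by simpa using hb) (by simpa using hd)] at hcd
    exact Subtype.ext hcd
  have hc : c ≠ 0 := by
    rintro rfl
    exact mul_ne_zero ha hd (hcross.trans (zero_mul b))
  have ord_ne_top : ∀ x : O, x ≠ 0 → Ring.ord O x ≠ ⊤ := fun x hx =>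
    Ring.ord_ne_top (mem_nonZeroDivisors_of_ne_zero hx)
  have hord := congrArg (fun x => (Ring.ord O x).toNat) hcross
  simp only [Ring.ord_mul _ (mem_nonZeroDivisors_of_ne_zero hd),
    Ring.ord_mul _ (mem_nonZeroDivisors_of_ne_zero hb),
    ENat.toNat_add (ord_ne_top a ha) (ord_ne_top d hd),
    ENat.toNat_add (ord_ne_top c hc) (ord_ne_top b hb)] at hord
  lia

theorem ordAlong_nonneg (O : Subring K) [IsNoetherianRing O] [Ring.KrullDimLE 1 O] {x : K}
    (hx : x ∈ O) (hx0 : x ≠ 0) : 0 ≤ ordAlong O x := by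
  have := ordAlong_div O (a := ⟨x, hx⟩) (b := 1) (fun h => hx0 (congrArg Subtype.val h)) one_ne_zero
  simp only [Subring.coe_one, div_one, Ring.ord_one, ENat.toNat_zero] at this
  rw [this]
  simp

theorem ordAlong_zpow_mul_div (O : Subring K) [IsNoetherianRing O] [Ring.KrullDimLE 1 O]
    {ϖ s t : O} (hϖ₀ : ϖ ≠ 0) (hϖ : Ring.ord O ϖ = 1) (hs : IsUnit s) (ht : IsUnit t) (r : ℤ) :
    ordAlong O ((ϖ : K) ^ r * (s / t)) = r := by
  have toNat_ord : ∀ (n : ℕ) {u : O}, IsUnit u → (Ring.ord O (ϖ ^ n * u)).toNat = n := by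
    intro n u hu
    rw [Ring.ord_mul_of_isUnit_right hu, Ring.ord_pow (mem_nonZeroDivisors_of_ne_zero hϖ₀), hϖ]
    simp
  have hfrac : (ϖ : K) ^ r * (s / t) =
      ((ϖ ^ r.toNat * s : O) : K) / ((ϖ ^ (-r).toNat * t : O) : K) := by
    have hϖK : (ϖ : K) ≠ 0 := by simpa using hϖ₀
    conv_lhs => rw [← Int.toNat_sub_toNat_neg r, zpow_sub₀ hϖK, zpow_natCast, zpow_natCast,
      div_mul_div_comm]
    rfl
  rw [hfrac, ordAlong_div O (mul_ne_zero (pow_ne_zero _ hϖ₀) hs.ne_zero)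
    (mul_ne_zero (pow_ne_zero _ hϖ₀) ht.ne_zero), toNat_ord _ hs, toNat_ord _ ht,
    Int.toNat_sub_toNat_neg]

theorem mem_ofPrime {A : Subring K} {P : Ideal A} [P.IsPrime] {x : K} :
    x ∈ (LocalSubring.ofPrime A P).toSubring ↔ ∃ a s : A, s ∉ P ∧ x = a / s := by
  constructor
  · intro hx
    obtain ⟨⟨a, s⟩, h⟩ := IsLocalization.surj P.primeCompl
      (⟨x, hx⟩ : (LocalSubring.ofPrime A P).toSubring)
    have hs : ((s : A) : K) ≠ 0 := fun h0 =>
      s.2 (by rw [show (s : A) = 0 from Subtype.ext h0]; exact P.zero_mem)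
    exact ⟨a, s, s.2, (eq_div_iff hs).2 (congrArg Subtype.val h)⟩
  · rintro ⟨a, s, hs, rfl⟩
    obtain ⟨u, hu⟩ := IsLocalization.map_units (LocalSubring.ofPrime A P).toSubring
      (⟨s, hs⟩ : P.primeCompl)
    have hinv : (((u⁻¹ : (LocalSubring.ofPrime A P).toSubringˣ) :
        (LocalSubring.ofPrime A P).toSubring) : K) = (s : K)⁻¹ := by
      refine eq_inv_of_mul_eq_one_left ?_
      rw [show (s : K) = _ from (congrArg Subtype.val hu).symm]
      exact congrArg Subtype.val (Units.inv_mul u)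
    rw [div_eq_mul_inv, ← hinv]
    exact mul_mem (LocalSubring.le_ofPrime A P a.2) (Subtype.mem _)

theorem isUnit_ofPrime {A : Subring K} {P : Ideal A} [P.IsPrime] {s : A} (hs : s ∉ P) :
    IsUnit (⟨s, LocalSubring.le_ofPrime A P s.2⟩ : (LocalSubring.ofPrime A P).toSubring) :=
  IsLocalization.map_units (LocalSubring.ofPrime A P).toSubring (⟨s, hs⟩ : P.primeCompl)

theorem isNoetherianRing_ofPrime (A : Subring K) [IsNoetherianRing A] (P : Ideal A) [P.IsPrime] :
    IsNoetherianRing (LocalSubring.ofPrime A P).toSubring :=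
  IsLocalization.isNoetherianRing P.primeCompl _ inferInstance

theorem ringKrullDim_ofPrime (A : Subring K) (P : Ideal A) [P.IsPrime] :
    ringKrullDim (LocalSubring.ofPrime A P).toSubring = P.height :=
  IsLocalization.AtPrime.ringKrullDim_eq_height P _

theorem krullDimLE_one_of_ringKrullDim_eq_one {R : Type*} [CommRing R] (h : ringKrullDim R = 1) :
    Ring.KrullDimLE 1 R :=
  Ring.krullDimLE_iff.2 h.le

theorem height_eq_one_of_eq_span {R : Type*} [CommRing R] [IsDomain R] [IsNoetherianRing R]
    {P : Ideal R} [hP : P.IsPrime] {ϖ : R} (hϖ : ϖ ≠ 0) (hPϖ : P = Ideal.span {ϖ}) :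
    P.height = 1 := by
  subst hPϖ
  exact Ideal.height_span_singleton_eq_one_of_mem_nonZeroDivisors
    (mem_nonZeroDivisors_of_ne_zero hϖ) (mt Ideal.span_singleton_eq_top.2 hP.ne_top)

theorem ord_ofPrime_generator {A : Subring K} {P : Ideal A} [P.IsPrime] {ϖ : A}
    (hP : P = Ideal.span {ϖ}) :
    Ring.ord (LocalSubring.ofPrime A P).toSubring ⟨ϖ, LocalSubring.le_ofPrime A P ϖ.2⟩ = 1 := by
  have hmax : Ideal.span {(⟨ϖ, LocalSubring.le_ofPrime A P ϖ.2⟩ :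
      (LocalSubring.ofPrime A P).toSubring)} =
      IsLocalRing.maximalIdeal (LocalSubring.ofPrime A P).toSubring := by
    rw [← IsLocalization.AtPrime.map_eq_maximalIdeal P (LocalSubring.ofPrime A P).toSubring]
    refine Eq.trans ?_ (congrArg (Ideal.map (algebraMap A _)) hP.symm)
    rw [Ideal.map_span, Set.image_singleton]
    rfl
  rw [Ring.ord, Module.length_eq_one_iff, isSimpleModule_iff_isCoatom, ← Ideal.isMaximal_def, hmax]
  infer_instance

theorem ordAlong_ofPrime {A : Subring K} [IsNoetherianRing A] {P : Ideal A} [P.IsPrime]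
    {ϖ : A} (hϖ : ϖ ≠ 0) (hP : P = Ideal.span {ϖ}) {s t : A} (hs : s ∉ P) (ht : t ∉ P) (r : ℤ) :
    ordAlong (LocalSubring.ofPrime A P).toSubring ((ϖ : K) ^ r * (s / t)) = r := by
  have := isNoetherianRing_ofPrime A P
  have := krullDimLE_one_of_ringKrullDim_eq_one
    ((ringKrullDim_ofPrime A P).trans (by rw [height_eq_one_of_eq_span hϖ hP]; rfl))
  have hϖ₀ : (⟨ϖ, LocalSubring.le_ofPrime A P ϖ.2⟩ : (LocalSubring.ofPrime A P).toSubring) ≠ 0 :=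
    fun h => hϖ (Subtype.ext
      (congrArg (Subtype.val : (LocalSubring.ofPrime A P).toSubring → K) h))
  exact ordAlong_zpow_mul_div _ hϖ₀ (ord_ofPrime_generator hP) (isUnit_ofPrime hs)
    (isUnit_ofPrime ht) r

end Order

/-! ### Charts of unimodular cones -/

section UnimodularCharts

variable {k : Type*} [Field k] {N : Type*} [AddCommGroup N]

/-- Generators of the monoid `σ^∨ ∩ M` for a cone `σ` spanned by the part `A` of the basis `b`. -/
def dualGenerators {ι : Type*} (b : Module.Basis ι ℤ N) (A : Finset N) : Set (DualLattice N) :=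
  Set.range b.coord ∪ {m | ∃ i, b i ∉ A ∧ m = -b.coord i}

theorem finite_dualGenerators {ι : Type*} [Finite ι] (b : Module.Basis ι ℤ N) (A : Finset N) :
    (dualGenerators b A).Finite := by
  refine (Set.finite_range _).union ((Set.finite_range fun i => -b.coord i).subset ?_)
  rintro _ ⟨i, -, rfl⟩
  exact ⟨i, rfl⟩

theorem dualGenerators_subset_dualPoints {ι : Type*} (b : Module.Basis ι ℤ N) {A : Finset N}
    (hA : (A : Set N) ⊆ Set.range b) : dualGenerators b A ⊆ dualPoints (coneOf A) := by
  classical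
  intro m hm
  refine mem_dualPoints_coneOf.2 fun v hv => ?_
  obtain ⟨j, rfl⟩ := hA hv
  obtain ⟨i, rfl⟩ | ⟨i, hi, rfl⟩ := hm
  · rw [b.coord_apply, b.repr_self, Finsupp.single_apply]
    split_ifs <;> simp
  · have : j ≠ i := fun h => hi (h ▸ hv)
    simp [this]

theorem dualPoints_subset_closure_dualGenerators {ι : Type*} [Finite ι] (b : Module.Basis ι ℤ N)
    (A : Finset N) : dualPoints (coneOf A) ⊆ AddSubmonoid.closure (dualGenerators b A) := by
  have := Fintype.ofFinite ι
  intro m hm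
  have hsum : m = ∑ i, m (b i) • b.coord i := b.ext fun j => by simp
  rw [hsum, SetLike.mem_coe]
  refine sum_mem fun i _ => ?_
  rcases le_or_gt 0 (m (b i)) with hi | hi
  · rw [← Int.toNat_of_nonneg hi, natCast_zsmul]
    exact nsmul_mem (AddSubmonoid.subset_closure (.inl ⟨i, rfl⟩)) _
  · have hbi : b i ∉ A := fun h => hi.not_ge (mem_dualPoints_coneOf.1 hm _ h)
    rw [← neg_neg (m (b i)), neg_smul, ← smul_neg, ← Int.toNat_of_nonneg (neg_pos.2 hi).le,
      natCast_zsmul]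
    exact nsmul_mem (AddSubmonoid.subset_closure (.inr ⟨i, hbi, rfl⟩)) _

theorem IsUnimodular.isNoetherianRing_chartRing {A : Finset N} (hA : IsUnimodular A) :
    IsNoetherianRing (chartRing k (coneOf A)) := by
  obtain ⟨b, hb⟩ := hA
  have hadjoin : Algebra.adjoin k (chi k '' dualPoints (coneOf A)) =
      Algebra.adjoin k (chi k '' dualGenerators b A) := by
    refine le_antisymm (Algebra.adjoin_le ?_)
      (Algebra.adjoin_mono (Set.image_mono (dualGenerators_subset_dualPoints b hb)))
    rintro _ ⟨m, hm, rfl⟩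
    exact chi_mem_of_mem_closure
      (O := (Algebra.adjoin k (chi k '' dualGenerators b A)).toSubmonoid)
      (fun m hm => Algebra.subset_adjoin ⟨m, hm, rfl⟩)
      (dualPoints_subset_closure_dualGenerators b A hm)
  have hfg : (Algebra.adjoin k (chi k '' dualPoints (coneOf A))).FG :=
    hadjoin ▸ Subalgebra.fg_def.2 ⟨_, (finite_dualGenerators b A).image _, rfl⟩
  have := (Subalgebra.fg_iff_finiteType _).1 hfg
  exact Algebra.FiniteType.isNoetherianRing k (Algebra.adjoin k (chi k '' dualPoints (coneOf A)))

theorem IsUnimodular.exists_translate_mem_dualPoints {A B : Finset N} (hA : IsUnimodular A)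
    (hB : B ⊆ A) (T : Finset (DualLattice N)) (hT : ↑T ⊆ dualPoints (coneOf B)) :
    ∃ m ∈ dualPoints (coneOf A), (∀ v ∈ B, m v = 0) ∧ ∀ t ∈ T, m + t ∈ dualPoints (coneOf A) := by
  classical
  obtain ⟨b, hb⟩ := hA
  set m : DualLattice N := b.constr ℤ fun i => if b i ∈ B then 0 else ∑ t ∈ T, |t (b i)| with hm
  have hmB : ∀ v ∈ B, m v = 0 := fun v hv => by
    obtain ⟨i, rfl⟩ := hb (hB hv)
    rw [hm, b.constr_basis, if_pos hv]
  have hmA : ∀ v ∈ A, v ∉ B → m v = ∑ t ∈ T, |t v| := fun v hv hvB => by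
    obtain ⟨i, rfl⟩ := hb hv
    rw [hm, b.constr_basis, if_neg hvB]
  refine ⟨m, mem_dualPoints_coneOf.2 fun v hv => ?_, hmB, fun t ht =>
    mem_dualPoints_coneOf.2 fun v hv => ?_⟩
  · by_cases hvB : v ∈ B
    · exact (hmB v hvB).ge
    · exact (hmA v hv hvB).ge.trans' (Finset.sum_nonneg fun t _ => abs_nonneg (t v))
  · rw [LinearMap.add_apply]
    by_cases hvB : v ∈ B
    · rw [hmB v hvB, zero_add]
      exact mem_dualPoints_coneOf.1 (hT ht) v hvB
    · rw [hmA v hv hvB]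
      linarith [neg_abs_le (t v),
        Finset.single_le_sum (f := fun t : DualLattice N => |t v|) (fun t _ => abs_nonneg (t v)) ht]

end UnimodularCharts

/-! ### Local rings of toric prime divisors -/

section ToricPrime

open AddMonoidAlgebra

variable {k : Type*} [Field k] {N : Type*} [AddCommGroup N]

theorem dualPoints_coneOf_singleton (v : N) : dualPoints (coneOf {v}) = {m | 0 ≤ m v} := by
  ext m
  simp only [mem_dualPoints_coneOf, Finset.mem_singleton, forall_eq, Set.mem_ofPred_eq]

theorem mem_perpPoints_coneOf_singleton {v : N} {m : DualLattice N} :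
    m ∈ perpPoints (coneOf {v}) ↔ m v = 0 := by
  refine ⟨fun h => ?_, fun h x hx => ?_⟩
  · simpa only [pairing_toMR_toNR, Int.cast_eq_zero] using
      h _ (toNR_mem_coneOf (Finset.mem_singleton_self v))
  · exact pairing_eq_zero_of_mem_coneOf (by simpa using h) hx

theorem orbitIdeal_coneOf_singleton {v : N} (hv : IsUnimodular {v}) :
    orbitIdeal k (coneOf {v}) =
      divisorIdeal k (coneOf {v}) v (toNR_mem_coneOf (Finset.mem_singleton_self v)) := by
  refine le_antisymm (Ideal.span_le.2 ?_) ?_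
  · rintro ⟨x, hx⟩ ⟨m, hm, hm', rfl⟩
    rw [mem_perpPoints_coneOf_singleton] at hm'
    have hmv : 0 ≤ m v := mem_dualPoints_coneOf.1 hm v (Finset.mem_singleton_self v)
    exact (chi_mem_divisorIdeal hm).2 (hmv.lt_of_ne' hm')
  · obtain ⟨m, hm1, hm0⟩ := hv.exists_dual (Finset.mem_singleton_self v)
    have hm : m ∈ dualPoints (coneOf {v}) := by
      rw [dualPoints_coneOf_singleton, Set.mem_ofPred_eq, hm1]
      exact zero_le_one
    rw [divisorIdeal_eq_span _ hm hm1 hm0, Ideal.span_singleton_le_iff_mem]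
    refine Ideal.subset_span ⟨m, hm, ?_, rfl⟩
    rw [mem_perpPoints_coneOf_singleton, hm1]
    exact one_ne_zero

theorem mem_ofPrime_divisorIdeal_iff {A : Finset N} (hA : IsUnimodular A) {v : N} (hv : v ∈ A)
    {x : FunctionField k N} :
    x ∈ (LocalSubring.ofPrime _ (divisorIdeal k (coneOf A) v (toNR_mem_coneOf hv))).toSubring ↔
      ∃ c ∈ supported k k {m : DualLattice N | 0 ≤ m v},
        ∃ d ∈ supported k k {m : DualLattice N | 0 ≤ m v},
          d ∉ supported k k {m : DualLattice N | 0 < m v} ∧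
            x = fromTorus k N c / fromTorus k N d := by
  classical
  rw [mem_ofPrime]
  constructor
  · rintro ⟨⟨y, hy⟩, ⟨z, hz⟩, hzv, rfl⟩
    obtain ⟨c, hc, rfl⟩ := mem_chartRing.1 hy
    obtain ⟨d, hd, rfl⟩ := mem_chartRing.1 hz
    have hsub : dualPoints (coneOf A) ⊆ {m | 0 ≤ m v} := fun m hm =>
      mem_dualPoints_coneOf.1 hm v hv
    exact ⟨c, supported_mono hsub hc, d, supported_mono hsub hd,
      mt (fromTorus_mem_divisorIdeal hz).2 hzv, rfl⟩
  · rintro ⟨c, hc, d, hd, hdv, rfl⟩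
    obtain ⟨m, -, hmv, hshift⟩ := hA.exists_translate_mem_dualPoints (B := {v})
      (Finset.singleton_subset_iff.2 hv) (c.coeff.support ∪ d.coeff.support) (by
        rw [dualPoints_coneOf_singleton, Finset.coe_union]
        exact Set.union_subset hc hd)
    specialize hmv v (Finset.mem_singleton_self v)
    have hc' : fromTorus k N (single m 1 * c) ∈ chartRing k (coneOf A) :=
      fromTorus_mem_chartRing.2 (single_mul_mem_supported fun t ht =>
        hshift t (Finset.mem_union_left _ ht))
    have hd' : fromTorus k N (single m 1 * d) ∈ chartRing k (coneOf A) :=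
      fromTorus_mem_chartRing.2 (single_mul_mem_supported fun t ht =>
        hshift t (Finset.mem_union_right _ ht))
    refine ⟨⟨_, hc'⟩, ⟨_, hd'⟩, fun h => hdv ?_, ?_⟩
    · rw [← single_mul_single_neg_mul (-m) d, neg_neg]
      refine single_mul_mem_supported fun t ht => ?_
      simpa [hmv] using (fromTorus_mem_divisorIdeal hd').1 h ht
    · simp only [map_mul, fromTorus_single_one]
      exact (mul_div_mul_left _ _ (chi_ne_zero m)).symm

theorem isLocalRingOfToricPrime_iff {A : Finset N} (hA : IsUnimodular A) {v : N} (hv : v ∈ A)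
    {O : LocalSubring (FunctionField k N)} :
    IsLocalRingOfToricPrime v O ↔
      O = LocalSubring.ofPrime _ (divisorIdeal k (coneOf A) v (toNR_mem_coneOf hv)) := by
  have hv₁ : IsUnimodular {v} := hA.mono (Finset.singleton_subset_iff.2 hv)
  have hmodel : LocalSubring.ofPrime _ (divisorIdeal k (coneOf {v}) v (toNR_mem_coneOf
      (Finset.mem_singleton_self v))) =
      LocalSubring.ofPrime _ (divisorIdeal k (coneOf A) v (toNR_mem_coneOf hv)) :=
    LocalSubring.toSubring_injective (SetLike.ext fun x =>
      (mem_ofPrime_divisorIdeal_iff hv₁ (Finset.mem_singleton_self v)).trans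
        (mem_ofPrime_divisorIdeal_iff hA hv).symm)
  rw [IsLocalRingOfToricPrime, ray_eq_coneOf, ← hmodel]
  simp only [orbitIdeal_coneOf_singleton hv₁]
  exact ⟨fun ⟨_, h⟩ => h, fun h => ⟨isPrime_divisorIdeal _ _ _, h⟩⟩

theorem IsUnimodular.exists_divisorIdeal_eq_span (k : Type*) [Field k] {A : Finset N}
    (hA : IsUnimodular A) {v : N} (hv : v ∈ A) :
    ∃ (m₁ : DualLattice N) (hm₁ : m₁ ∈ dualPoints (coneOf A)), m₁ v = 1 ∧
      divisorIdeal k (coneOf A) v (toNR_mem_coneOf hv) =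
        Ideal.span {⟨chi k m₁, chi_mem_chartRing hm₁⟩} := by
  obtain ⟨m₁, h1, h0⟩ := hA.exists_dual hv
  have hm₁ : m₁ ∈ dualPoints (coneOf A) := mem_dualPoints_coneOf.2 fun w hw => by
    by_cases hwv : w = v
    · exact hwv ▸ h1.ge.trans' zero_le_one
    · exact (h0 w hw hwv).ge
  exact ⟨m₁, hm₁, h1, divisorIdeal_eq_span _ hm₁ h1 h0⟩

theorem IsUnimodular.height_divisorIdeal {A : Finset N} (hA : IsUnimodular A) {v : N}
    (hv : v ∈ A) : (divisorIdeal k (coneOf A) v (toNR_mem_coneOf hv)).height = 1 := by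
  have := hA.isNoetherianRing_chartRing (k := k)
  obtain ⟨m₁, hm₁, -, hspan⟩ := hA.exists_divisorIdeal_eq_span k hv
  exact height_eq_one_of_eq_span (fun h => chi_ne_zero m₁ (congrArg Subtype.val h)) hspan

theorem ordAlong_toricPrime {v : N} (hv : IsUnimodular {v}) {O : LocalSubring (FunctionField k N)}
    (hO : IsLocalRingOfToricPrime v O) {a : AddMonoidAlgebra k (DualLattice N)} {r : ℤ}
    (ha : a ∈ supported k k {m : DualLattice N | r ≤ m v})
    (ha' : a ∉ supported k k {m : DualLattice N | r < m v}) :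
    ordAlong O.toSubring (fromTorus k N a) = r := by
  have hmem := Finset.mem_singleton_self v
  have := hv.isNoetherianRing_chartRing (k := k)
  obtain rfl := (isLocalRingOfToricPrime_iff hv hmem).1 hO
  obtain ⟨m₁, hm₁, h1, hspan⟩ := hv.exists_divisorIdeal_eq_span k hmem
  have hshift : single (r • m₁) 1 * (single (-(r • m₁)) 1 * a) = a :=
    single_mul_single_neg_mul _ a
  set b := single (-(r • m₁)) 1 * a
  have hbO : fromTorus k N b ∈ chartRing k (coneOf {v}) := by
    rw [fromTorus_mem_chartRing, dualPoints_coneOf_singleton]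
    refine single_mul_mem_supported fun m hm => ?_
    simpa [h1] using ha hm
  have hbP : (⟨fromTorus k N b, hbO⟩ : chartRing k (coneOf {v})) ∉
      divisorIdeal k (coneOf {v}) v (toNR_mem_coneOf hmem) := fun h => ha' (by
    rw [← hshift]
    refine single_mul_mem_supported fun m hm => ?_
    simpa [h1] using (fromTorus_mem_divisorIdeal hbO).1 h hm)
  have hfactor : fromTorus k N a =
      chi k m₁ ^ r * (fromTorus k N b / ((1 : chartRing k (coneOf {v})) : FunctionField k N)) := by
    rw [Subring.coe_one, div_one, ← hshift, map_mul, fromTorus_single_one, chi_zsmul]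
  rw [hfactor]
  exact ordAlong_ofPrime (fun h => chi_ne_zero m₁ (congrArg Subtype.val h)) hspan hbP
    ((Ideal.ne_top_iff_one _).1 (isPrime_divisorIdeal _ _ _).ne_top) r

theorem le_ordAlong_toricPrime_iff {v : N} (hv : IsUnimodular {v})
    {O : LocalSubring (FunctionField k N)} (hO : IsLocalRingOfToricPrime v O)
    {a : AddMonoidAlgebra k (DualLattice N)} (ha : a ≠ 0) {n : ℤ} :
    n ≤ ordAlong O.toSubring (fromTorus k N a) ↔
      a ∈ supported k k {m : DualLattice N | n ≤ m v} := by
  have hne : a.coeff.support.Nonempty := by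
    rw [Finsupp.support_nonempty_iff]
    simpa using ha
  obtain ⟨m, hm, hmin⟩ := Finset.exists_min_image _ (fun m : DualLattice N => m v) hne
  rw [ordAlong_toricPrime hv hO (r := m v) hmin fun h => lt_irrefl _ (show m v < m v from h hm)]
  exact ⟨fun hn m' hm' => hn.trans (hmin m' hm'), fun h => h hm⟩

theorem ordAlong_chi {v : N} (hv : IsUnimodular {v}) {O : LocalSubring (FunctionField k N)}
    (hO : IsLocalRingOfToricPrime v O) (m : DualLattice N) :
    ordAlong O.toSubring (chi k m) = m v := by
  rw [← fromTorus_single_one]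
  refine ordAlong_toricPrime hv hO (r := m v)
    (single_mem_supported (show m ∈ {m' : DualLattice N | m v ≤ m' v} from le_refl (m v)) 1)
    fun h => ?_
  exact lt_irrefl (m v) (h (by simp : m ∈ (single m (1 : k)).coeff.support))

theorem IsLocalRingOfToricPrime.unique {v w : N} (hv : IsUnimodular {v}) (hw : IsUnimodular {w})
    {O : LocalSubring (FunctionField k N)} (hvO : IsLocalRingOfToricPrime v O)
    (hwO : IsLocalRingOfToricPrime w O) : v = w := by
  have ⟨b, _⟩ := hv
  exact b.ext_elem fun i =>
    (ordAlong_chi hv hvO (b.coord i)).symm.trans (ordAlong_chi hw hwO (b.coord i))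

end ToricPrime

/-! ### Prime divisors -/

section PrimeDivisors

open AddMonoidAlgebra

variable {k : Type*} [Field k] {N : Type*} [AddCommGroup N]

theorem chi_mem_ofPrime_or_divisorIdeal_le {A : Finset N} (hA : IsUnimodular A)
    (P : Ideal (chartRing k (coneOf A))) [P.IsPrime] :
    (∀ m, chi k m ∈ (LocalSubring.ofPrime (chartRing k (coneOf A)) P).toSubring) ∨
      ∃ (v : N) (hv : v ∈ A), divisorIdeal k (coneOf A) v (toNR_mem_coneOf hv) ≤ P := by
  refine or_iff_not_imp_right.2 fun hdivisor m => ?_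
  obtain ⟨b, hb⟩ := hA
  have hcoord (i) : b.coord i ∈ dualPoints (coneOf A) :=
    dualGenerators_subset_dualPoints b hb (.inl ⟨i, rfl⟩)
  have hcoordP (i) (hi : b i ∈ A) : ⟨chi k (b.coord i), chi_mem_chartRing (hcoord i)⟩ ∉ P := by
    refine fun hP => hdivisor ⟨b i, hi, ?_⟩
    rwa [divisorIdeal_eq_span _ (hcoord i) (by simp) fun w hw hne => ?_,
      Ideal.span_singleton_le_iff_mem]
    obtain ⟨j, rfl⟩ := hb hw
    have hji : j ≠ i := fun h => hne (h ▸ rfl)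
    simp [hji]
  have hgen : ∀ m ∈ dualGenerators b ∅,
      chi k m ∈ (LocalSubring.ofPrime (chartRing k (coneOf A)) P).toSubring.toSubmonoid := by
    rintro _ (⟨i, rfl⟩ | ⟨i, -, rfl⟩)
    · exact LocalSubring.le_ofPrime _ _ (chi_mem_chartRing (hcoord i))
    by_cases hi : b i ∈ A
    · exact mem_ofPrime.2 ⟨1, ⟨_, chi_mem_chartRing (hcoord i)⟩, hcoordP i hi, by
        rw [Subring.coe_one, one_div, chi_neg]⟩
    · exact LocalSubring.le_ofPrime _ _ (chi_mem_chartRing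
        (dualGenerators_subset_dualPoints b hb (.inr ⟨i, hi, rfl⟩)))
  exact chi_mem_of_mem_closure hgen (dualPoints_subset_closure_dualGenerators b ∅
    (mem_dualPoints_coneOf.2 fun v hv => absurd hv (Finset.notMem_empty v)))

theorem Fan.isUnimodular_of_mem_rays [Module.Free ℤ N] {S : Fan N} (hS : S.IsSmooth) {v : N}
    (hv : v ∈ S.rays) : IsUnimodular {v} := by
  obtain ⟨K, rfl⟩ := SmoothComplex.exists_toFan_eq hS ⟨_, hv.2⟩
  exact K.unimodular _ (K.mem_rays_toFan.1 hv)

namespace PrimeDivisor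

variable {S : Fan N} (hS : S.IsSmooth) (E : PrimeDivisor k S)
include hS

theorem isNoetherianRing : IsNoetherianRing E.1.toSubring := by
  obtain ⟨_, ⟨σ, hσ, P, _, rfl⟩, -⟩ := E
  obtain ⟨A, hA, rfl⟩ := hS.exists_eq_coneOf hσ
  have := hA.isNoetherianRing_chartRing (k := k)
  exact isNoetherianRing_ofPrime _ _

/-- Both the toric prime ideal and `P` have height one, so an inclusion between them is an
equality. -/
theorem chi_mem_or_exists_isLocalRingOfToricPrime :
    (∀ m, chi k m ∈ E.1.toSubring) ∨ ∃ v : S.rays, IsLocalRingOfToricPrime (v : N) E.1 := by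
  obtain ⟨_, ⟨σ, hσ, P, _, rfl⟩, hdim⟩ := E
  obtain ⟨A, hA, rfl⟩ := hS.exists_eq_coneOf hσ
  have := hA.isNoetherianRing_chartRing (k := k)
  refine (chi_mem_ofPrime_or_divisorIdeal_le hA P).imp id ?_
  rintro ⟨v, hv, hle⟩
  have hray : v ∈ S.rays := ⟨hA.isPrimitive hv, ray_eq_coneOf v ▸
    S.face_mem _ hσ _ (hA.isFaceOf_coneOf (Finset.singleton_subset_iff.2 hv))⟩
  have hP : P.height = 1 := by
    rw [ringKrullDim_ofPrime] at hdim
    exact_mod_cast hdim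
  obtain rfl := Ideal.eq_of_le_of_height_le _ hle (by rw [hP, hA.height_divisorIdeal hv])
  exact ⟨⟨v, hray⟩, (isLocalRingOfToricPrime_iff hA hv).2 rfl⟩

omit hS in
theorem fromTorus_mem_of_chi_mem (h : ∀ m, chi k m ∈ E.1.toSubring)
    (a : AddMonoidAlgebra k (DualLattice N)) : fromTorus k N a ∈ E.1.toSubring := by
  obtain ⟨σ, -, P, _, hE⟩ := E.2.1
  have hchart : chartRing k σ ≤ E.1.toSubring := hE ▸ LocalSubring.le_ofPrime _ P
  rw [← sum_coeff_single a, Finsupp.sum, map_sum]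
  refine sum_mem fun m _ => ?_
  rw [← mul_one (a.coeff m), ← smul_eq_mul, ← smul_single, map_smul, fromTorus_single_one,
    Algebra.smul_def]
  exact mul_mem (hchart (Subalgebra.algebraMap_mem (Algebra.adjoin k _) _)) (h m)

theorem ordAlong_fromTorus_nonneg (h : ∀ m, chi k m ∈ E.1.toSubring)
    {a : AddMonoidAlgebra k (DualLattice N)} (ha : a ≠ 0) :
    0 ≤ ordAlong E.1.toSubring (fromTorus k N a) := by
  have := E.isNoetherianRing hS
  have := krullDimLE_one_of_ringKrullDim_eq_one E.2.2
  exact ordAlong_nonneg _ (E.fromTorus_mem_of_chi_mem h a)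
    ((map_ne_zero_iff _ fromTorus_injective).2 ha)

variable [Module.Free ℤ N]

theorem not_isLocalRingOfToricPrime_of_chi_mem (h : ∀ m, chi k m ∈ E.1.toSubring) {v : N}
    (hv : v ∈ S.rays) : ¬ IsLocalRingOfToricPrime v E.1 := by
  intro hE
  have hv' := Fan.isUnimodular_of_mem_rays hS hv
  obtain ⟨m, hm, -⟩ := hv'.exists_dual (Finset.mem_singleton_self v)
  have hord := E.ordAlong_fromTorus_nonneg hS h (a := single (-m) 1)
    (single_ne_zero.2 one_ne_zero)
  rw [fromTorus_single_one, ordAlong_chi hv' hE, LinearMap.neg_apply, hm] at hord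
  exact absurd hord (by decide)

theorem toWeilDiv_of_chi_mem (D : S.ToricDiv ℤ) (h : ∀ m, chi k m ∈ E.1.toSubring) :
    toWeilDiv k D E = 0 :=
  (finsum_congr fun v => if_neg (E.not_isLocalRingOfToricPrime_of_chi_mem hS h v.2)).trans
    finsum_zero

theorem toWeilDiv_of_isLocalRingOfToricPrime (D : S.ToricDiv ℤ) {v : S.rays}
    (hv : IsLocalRingOfToricPrime (v : N) E.1) : toWeilDiv k D E = D v := by
  rw [toWeilDiv, finsum_eq_single _ v, if_pos hv]
  exact fun w hwv => if_neg fun hw => hwv (Subtype.ext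
    (hw.unique (Fan.isUnimodular_of_mem_rays hS w.2) (Fan.isUnimodular_of_mem_rays hS v.2) hv))

end PrimeDivisor

theorem Fan.exists_primeDivisor_of_mem_rays (k : Type*) [Field k] [Module.Free ℤ N] {S : Fan N}
    (hS : S.IsSmooth) {v : N} (hv : v ∈ S.rays) :
    ∃ E : PrimeDivisor k S, IsLocalRingOfToricPrime v E.1 := by
  have hv' := Fan.isUnimodular_of_mem_rays hS hv
  have hmem := Finset.mem_singleton_self v
  refine ⟨⟨LocalSubring.ofPrime _ (divisorIdeal k (coneOf {v}) v (toNR_mem_coneOf hmem)),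
    ⟨_, ray_eq_coneOf v ▸ hv.2, _, inferInstance, rfl⟩, ?_⟩,
    (isLocalRingOfToricPrime_iff hv' hmem).2 rfl⟩
  rw [ringKrullDim_ofPrime, hv'.height_divisorIdeal hmem]
  rfl

end PrimeDivisors

/-! ### Factoriality of the coordinate ring of the torus -/

section Factoriality

open AddMonoidAlgebra

theorem exists_eq_zpow_mul_div_of_notMem_range {R K : Type*} [CommRing R] [IsDomain R]
    [UniqueFactorizationMonoid R] [Field K] [Algebra R K] [IsFractionRing R K] {f : K}
    (hf : f ∉ Set.range (algebraMap R K)) :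
    ∃ p a b : R, Prime p ∧ ¬ p ∣ a ∧ ¬ p ∣ b ∧ ∃ n : ℕ, n ≠ 0 ∧
      f = algebraMap R K p ^ (-n : ℤ) * (algebraMap R K a / algebraMap R K b) := by
  obtain ⟨a, ⟨b, hb⟩, hab, rfl⟩ := IsFractionRing.exists_reduced_fraction (A := R) f
  have hb0 : b ≠ 0 := nonZeroDivisors.ne_zero hb
  have hbu : ¬ IsUnit b := fun h => hf ⟨a * ↑h.unit⁻¹, by
    rw [IsFractionRing.mk'_eq_div, eq_div_iff ((map_ne_zero_iff _
      (IsFractionRing.injective R K)).2 hb0), ← map_mul, mul_assoc, h.val_inv_mul, mul_one]⟩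
  obtain ⟨p, hp, hpb⟩ := WfDvdMonoid.exists_irreducible_factor hbu hb0
  obtain ⟨n, b', hpb', rfl⟩ := WfDvdMonoid.max_power_factor hb0 hp
  refine ⟨p, a, b', hp.prime, fun hpa => hp.not_isUnit (hab hpa hpb), hpb', n, ?_, ?_⟩
  · rintro rfl
    exact hpb' (by simpa using hpb)
  · rw [IsFractionRing.mk'_eq_div, map_mul, map_pow, zpow_neg, zpow_natCast, ← div_eq_inv_mul,
      div_div, mul_comm]

theorem isLocalization_mapDomainRingHom {k M G : Type*} [CommRing k] [AddCommMonoid M]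
    [AddCommGroup G] (f : M →+ G) (hf : Function.Injective f)
    (hshift : ∀ T : Finset G, ∃ d, ∀ t ∈ T, f d + t ∈ Set.range f) :
    letI := (mapDomainRingHom k f).toAlgebra
    IsLocalization (MonoidHom.mrange (AddMonoidAlgebra.of k M)) (AddMonoidAlgebra k G) := by
  let _ := (mapDomainRingHom k f).toAlgebra
  have hsingle (d : M) : algebraMap (AddMonoidAlgebra k M) (AddMonoidAlgebra k G) (single d 1) =
      single (f d) 1 := mapDomain_single
  refine ⟨?_, fun a => ?_, fun h => ⟨1, by rw [mapDomain_injective hf h]⟩⟩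
  · rintro ⟨_, d, rfl⟩
    refine .of_mul_eq_one (single (-f d.toAdd) 1) ((congrArg (· * _) (hsingle _)).trans ?_)
    rw [single_mul_single, add_neg_cancel, mul_one, one_def]
  · obtain ⟨d, hd⟩ := hshift a.coeff.support
    have hmem : single (f d) 1 * a ∈ supported k k (Set.range f) := single_mul_mem_supported hd
    refine ⟨⟨comapDomain f hf (single (f d) 1 * a), ⟨_, .ofAdd d, rfl⟩⟩, ?_⟩
    refine (congrArg (a * ·) (hsingle d)).trans ((mul_comm _ _).trans ?_)
    exact (mapDomain_comapDomain hmem hf).symm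

variable {k : Type*} [Field k] {N : Type*} [AddCommGroup N] {ι : Type*}

/-- The inclusion of `ℕ^ι` into the dual lattice given by the basis dual to `b`. -/
def exponentHom (b : Module.Basis ι ℤ N) : (ι →₀ ℕ) →+ DualLattice N where
  toFun d := b.constr ℤ fun i => (d i : ℤ)
  map_zero' := b.ext fun i => by simp
  map_add' d e := b.ext fun i => by simp

theorem exponentHom_apply (b : Module.Basis ι ℤ N) (d : ι →₀ ℕ) (i : ι) :
    exponentHom b d (b i) = d i := by
  simp [exponentHom]

theorem exponentHom_injective (b : Module.Basis ι ℤ N) :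
    Function.Injective (exponentHom b) := fun d e h => by
  ext i
  exact_mod_cast (exponentHom_apply b d i).symm.trans (h ▸ exponentHom_apply b e i)

theorem mem_range_exponentHom [Finite ι] {b : Module.Basis ι ℤ N} {m : DualLattice N} :
    m ∈ Set.range (exponentHom b) ↔ ∀ i, 0 ≤ m (b i) := by
  constructor
  · rintro ⟨d, rfl⟩ i
    rw [exponentHom_apply]
    exact Int.natCast_nonneg _
  · refine fun h => ⟨Finsupp.equivFunOnFinite.symm fun i => (m (b i)).toNat, b.ext fun i => ?_⟩
    rw [exponentHom_apply]
    exact Int.toNat_of_nonneg (h i)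

theorem exists_exponentHom_add_mem_range [Finite ι] (b : Module.Basis ι ℤ N)
    (T : Finset (DualLattice N)) :
    ∃ d, ∀ t ∈ T, exponentHom b d + t ∈ Set.range (exponentHom b) := by
  refine ⟨Finsupp.equivFunOnFinite.symm fun i => ∑ t ∈ T, (t (b i)).natAbs, fun t ht => ?_⟩
  refine mem_range_exponentHom.2 fun i => ?_
  have := Finset.single_le_sum (f := fun t : DualLattice N => (t (b i)).natAbs)
    (fun _ _ => Nat.zero_le _) ht
  rw [LinearMap.add_apply, exponentHom_apply, Finsupp.equivFunOnFinite_symm_apply_apply]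
  lia

theorem uniqueFactorizationMonoid_torus [Module.Free ℤ N] [Module.Finite ℤ N] :
    UniqueFactorizationMonoid (AddMonoidAlgebra k (DualLattice N)) := by
  let b := Module.Free.chooseBasis ℤ N
  let _ := (mapDomainRingHom k (exponentHom b)).toAlgebra
  have := isLocalization_mapDomainRingHom (k := k) _ (exponentHom_injective b)
    (exists_exponentHom_add_mem_range b)
  have : UniqueFactorizationMonoid
      (AddMonoidAlgebra k (Module.Free.ChooseBasisIndex ℤ N →₀ ℕ)) :=
    inferInstanceAs (UniqueFactorizationMonoid (MvPolynomial _ k))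
  exact .of_isLocalization
    (MonoidHom.mrange (AddMonoidAlgebra.of k (Module.Free.ChooseBasisIndex ℤ N →₀ ℕ))) _

end Factoriality

/-! ### Sections over the torus -/

section TorusChart

variable {k : Type*} [Field k] {N : Type*} [AddCommGroup N]

theorem fromTorus_mem_torusChart (a : AddMonoidAlgebra k (DualLattice N)) :
    fromTorus k N a ∈ chartRing k (coneOf (∅ : Finset N)) :=
  fromTorus_mem_chartRing.2 fun _ _ =>
    mem_dualPoints_coneOf.2 fun v hv => absurd hv (Finset.notMem_empty v)

/-- The coordinate ring `k[M]` of the torus is the chart ring of the zero cone. -/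
def torusChartEquiv (k : Type*) [Field k] (N : Type*) [AddCommGroup N] :
    AddMonoidAlgebra k (DualLattice N) ≃+* chartRing k (coneOf (∅ : Finset N)) :=
  RingEquiv.ofBijective
    ((fromTorus k N).toRingHom.codRestrict (chartRing k (coneOf ∅)) fromTorus_mem_torusChart)
    ⟨fun _ _ h => fromTorus_injective (congrArg Subtype.val h), fun ⟨_, hx⟩ =>
      let ⟨a, _, ha⟩ := mem_chartRing.1 hx
      ⟨a, Subtype.ext ha⟩⟩

namespace Fan

variable {S : Fan N} (hS : S.IsSmooth) (hne : S.cones.Nonempty)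
include hS hne

theorem exists_primeDivisor_of_prime {p : AddMonoidAlgebra k (DualLattice N)} (hp : Prime p) :
    ∃ E : PrimeDivisor k S, (∀ m, chi k m ∈ E.1.toSubring) ∧
      ∀ a b, ¬ p ∣ a → ¬ p ∣ b → ∀ r : ℤ,
        ordAlong E.1.toSubring (fromTorus k N p ^ r * (fromTorus k N a / fromTorus k N b)) = r := by
  obtain ⟨σ, hσ⟩ := hne
  obtain ⟨A, hA, rfl⟩ := hS.exists_eq_coneOf hσ
  have hzero : coneOf ∅ ∈ S.cones :=
    S.face_mem _ hσ _ (hA.isFaceOf_coneOf (Finset.empty_subset A))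
  have := (hA.mono (Finset.empty_subset A)).isNoetherianRing_chartRing (k := k)
  let e := torusChartEquiv k N
  have hep : Prime (e p) := (MulEquiv.prime_iff e.toMulEquiv).2 hp
  have hprime : (Ideal.span {e p}).IsPrime := (Ideal.span_singleton_prime hep.ne_zero).2 hep
  have hmem {a} (ha : ¬ p ∣ a) : e a ∉ Ideal.span {e p} :=
    fun h => ha ((map_dvd_iff e).1 (Ideal.mem_span_singleton.1 h))
  refine ⟨⟨.ofPrime _ (Ideal.span {e p}), ⟨_, hzero, _, hprime, rfl⟩, ?_⟩, fun m => ?_,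
    fun a b ha hb r => ordAlong_ofPrime hep.ne_zero rfl (hmem ha) (hmem hb) r⟩
  · rw [ringKrullDim_ofPrime, height_eq_one_of_eq_span hep.ne_zero rfl]
    rfl
  · exact LocalSubring.le_ofPrime _ _ (fromTorus_mem_torusChart _)

theorem exists_fromTorus_eq_of_ordAlong_nonneg [Module.Free ℤ N] [Module.Finite ℤ N]
    {f : FunctionField k N}
    (h : ∀ E : PrimeDivisor k S, (∀ m, chi k m ∈ E.1.toSubring) → 0 ≤ ordAlong E.1.toSubring f) :
    ∃ a, fromTorus k N a = f := by
  by_contra hf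
  have := uniqueFactorizationMonoid_torus (k := k) (N := N)
  obtain ⟨p, a, b, hp, hpa, hpb, n, hn, rfl⟩ :=
    exists_eq_zpow_mul_div_of_notMem_range (R := AddMonoidAlgebra k (DualLattice N)) hf
  obtain ⟨E, hE, hord⟩ := exists_primeDivisor_of_prime hS hne hp
  have hneg : 0 ≤ (-n : ℤ) := hord a b hpa hpb (-n) ▸ h E hE
  lia

end Fan

end TorusChart

/-! ### Global sections -/

section GlobalSections

open AddMonoidAlgebra

variable {k : Type*} [Field k] {N : Type*} [AddCommGroup N] [Module.Free ℤ N]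

namespace Fan

variable {S : Fan N} (hS : S.IsSmooth) (D : S.ToricDiv ℤ)
include hS

theorem nonneg_divisorOf_fromTorus_add_toWeilDiv_iff {a : AddMonoidAlgebra k (DualLattice N)}
    (ha : a ≠ 0) : 0 ≤ divisorOf S (fromTorus k N a) + toWeilDiv k D ↔
      a ∈ supported k k {m | ∀ v : S.rays, 0 ≤ m v + D v} := by
  have htoric (v : S.rays) {E : PrimeDivisor k S} (hE : IsLocalRingOfToricPrime (v : N) E.1) :
      0 ≤ divisorOf S (fromTorus k N a) E + D v ↔ ∀ m ∈ a.coeff.support, 0 ≤ m v + D v := by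
    simp only [← neg_le_iff_add_nonneg]
    exact le_ordAlong_toricPrime_iff (Fan.isUnimodular_of_mem_rays hS v.2) hE ha
  constructor
  · intro h m hm v
    obtain ⟨E, hE⟩ := Fan.exists_primeDivisor_of_mem_rays k hS v.2
    have hEv := h E
    rw [Pi.add_apply, E.toWeilDiv_of_isLocalRingOfToricPrime hS D hE] at hEv
    exact (htoric v hE).1 hEv m hm
  · intro h E
    rw [Pi.zero_apply, Pi.add_apply]
    obtain hE | ⟨v, hE⟩ := E.chi_mem_or_exists_isLocalRingOfToricPrime hS
    · rw [E.toWeilDiv_of_chi_mem hS D hE, add_zero]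
      exact E.ordAlong_fromTorus_nonneg hS hE ha
    · rw [E.toWeilDiv_of_isLocalRingOfToricPrime hS D hE]
      exact (htoric v hE).2 fun m hm => h hm v

theorem nonneg_divisorOf_add_toWeilDiv_iff [Module.Finite ℤ N] (hne : S.cones.Nonempty)
    {f : FunctionField k N} (hf : f ≠ 0) : 0 ≤ divisorOf S f + toWeilDiv k D ↔
      f ∈ Submodule.span k (chi k '' {m : DualLattice N | ∀ v : S.rays, 0 ≤ m v + D v}) := by
  have key {a : AddMonoidAlgebra k (DualLattice N)} (ha : fromTorus k N a ≠ 0) :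
      0 ≤ divisorOf S (fromTorus k N a) + toWeilDiv k D ↔
        fromTorus k N a ∈
          Submodule.span k (chi k '' {m : DualLattice N | ∀ v : S.rays, 0 ≤ m v + D v}) :=
    (nonneg_divisorOf_fromTorus_add_toWeilDiv_iff hS D
      ((map_ne_zero_iff _ fromTorus_injective).1 ha)).trans fromTorus_mem_span_chi.symm
  constructor
  · intro h
    obtain ⟨a, rfl⟩ := exists_fromTorus_eq_of_ordAlong_nonneg hS hne fun E hE => by
      have hEf := h E
      rwa [Pi.add_apply, E.toWeilDiv_of_chi_mem hS D hE, add_zero] at hEf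
    exact (key hf).1 h
  · intro h
    obtain ⟨a, -, rfl⟩ := mem_span_chi.1 h
    exact (key hf).2 h

end Fan

omit [Module.Free ℤ N] in
theorem mem_span_chi_iInter {ι : Type*} [Nonempty ι] {T : ι → Set (DualLattice N)}
    {f : FunctionField k N} : f ∈ Submodule.span k (chi k '' ⋂ i, T i) ↔
      ∀ i, f ∈ Submodule.span k (chi k '' T i) := by
  refine ⟨fun h i => Submodule.span_mono (Set.image_mono (Set.iInter_subset T i)) h, fun h => ?_⟩
  obtain ⟨a, -, rfl⟩ := mem_span_chi.1 (h (Classical.arbitrary ι))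
  exact fromTorus_mem_span_chi.2 (Set.subset_iInter fun i => fromTorus_mem_span_chi.1 (h i))

namespace ToricBDivisor

omit [Module.Free ℤ N] in
theorem toMR_mem_Delta {S : Fan N} {D : ToricBDivisor S} {m : DualLattice N} :
    toMR m ∈ D.Delta ↔ ∀ (S' : S.R) (v : S'.1.rays), 0 ≤ m v + ⌊D.inc S' v⌋ := by
  simp only [Delta, Set.mem_iInter, Fan.polyhedron, Set.mem_ofPred_eq, pairing_toMR_toNR]
  refine forall_congr' fun S' => forall_congr' fun v => ?_
  rw [← neg_le_iff_add_nonneg', Int.le_floor, Int.cast_neg, neg_le]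
  exact_mod_cast Iff.rfl

theorem globalSections_eq [Module.Finite ℤ N] {S : Fan N} (hS : S.IsSmooth)
    (hne : S.cones.Nonempty) (D : ToricBDivisor S) :
    D.globalSections k = (Submodule.span k (chi k '' {m | toMR m ∈ D.Delta}) :
        Set (FunctionField k N)) := by
  ext f
  rcases eq_or_ne f 0 with rfl | hf
  · exact iff_of_true (.inr rfl) (Submodule.zero_mem _)
  have : Nonempty S.R := ⟨⟨S, hS, .refl S⟩⟩
  have hDelta : {m | toMR m ∈ D.Delta} =
      ⋂ S' : S.R, {m : DualLattice N | ∀ v : S'.1.rays, 0 ≤ m v + ⌊D.inc S' v⌋} := by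
    ext m
    rw [Set.mem_ofPred_eq, toMR_mem_Delta, Set.mem_iInter]
    rfl
  have hsections : f ∈ D.globalSections k ↔
      ∀ S' : S.R, 0 ≤ divisorOf S'.1 f + toWeilDiv k fun v => ⌊D.inc S' v⌋ :=
    (or_iff_left hf).trans (and_iff_right hf)
  rw [hsections, SetLike.mem_coe, hDelta, mem_span_chi_iInter]
  exact forall_congr' fun S' => Fan.nonneg_divisorOf_add_toWeilDiv_iff S'.2.1 _
    (S'.2.2.nonempty hne) hf

end ToricBDivisor

end GlobalSections

theorem mainTheorem6_general {k : Type*} [Field k] {N : Type*} [AddCommGroup N]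
    [Module.Free ℤ N] [Module.Finite ℤ N] (S : Fan N) (hsmooth : S.IsSmooth)
    (hne : S.cones.Nonempty) (D : ToricBDivisor S) :
    D.globalSections k = (Submodule.span k (chi k '' {m | toMR m ∈ D.Delta}) :
        Set (FunctionField k N)) ∧
      LinearIndependent k (fun m : {m : DualLattice N // toMR m ∈ D.Delta} => chi k m.1) ∧
      D.Delta = {m : MR N | ∀ v : N, IsPrimitive v → toNR v ∈ S.support →
        (D.phi v : ℝ) ≤ pairing N m (toNR v)} :=
  ⟨D.globalSections_eq hsmooth hne, linearIndependent_chi.comp _ Subtype.val_injective,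
    D.Delta_eq hne hsmooth⟩

end

end ToricB

open ToricB in
theorem mainTheorem6 {k : Type*} [Field k] [IsAlgClosed k]
    {N : Type*} [AddCommGroup N] [Module.Free ℤ N] [Module.Finite ℤ N]
    (S : Fan N) (hsmooth : S.IsSmooth) (hcomplete : S.IsComplete) (D : ToricBDivisor S) :
    D.globalSections k = (Submodule.span k (chi k '' {m | toMR m ∈ D.Delta}) :
        Set (FunctionField k N)) ∧
      LinearIndependent k (fun m : {m : DualLattice N // toMR m ∈ D.Delta} => chi k m.1) ∧
      D.Delta = {m : MR N | ∀ v : N, IsPrimitive v →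
        (D.phi v : ℝ) ≤ pairing N m (toNR v)} := by
  have hzero : (0 : NR N) ∈ S.support := hcomplete ▸ Set.mem_univ 0
  have hne : S.cones.Nonempty := (Fan.mem_support.1 hzero).imp fun _ h => h.1
  simpa only [show S.support = Set.univ from hcomplete, Set.mem_univ, true_imp_iff] using
    mainTheorem6_general (k := k) S hsmooth hne D
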